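/- For $A,B\subset\mathbb R^n$ ($n\ge 1$) let $|\cdot|$ denote (outer) Lebesgue measure, $\operatorname{co}$ the convex hull, $A+B$ the Minkowski sum, and, when $0<|A|,|B|<\infty$, put $$t(A,B)=\frac{|A|^{1/n}}{|A|^{1/n}+|B|^{1/n}},\qquad \delta(A,B)=\frac{|A+B|^{1/n}}{|A|^{1/n}+|B|^{1/n}}-1,$$ $$\alpha(A,B)=\inf_{x\in\mathbb R^n}\frac{|A\,\triangle\,(s\cdot\operatorname{co}(B)+x)|}{|A|},\quad\text{where } s>0 \text{ satisfies } |A|=|s\cdot\operatorname{co}(B)|$$ (with $\alpha(A,B)=\infty$ if $|\operatorname{co}(B)|=\infty$), and $$\omega(A,B)=\inf\max\left\{\frac{|K_A\setminus A|}{|A|},\frac{|K_B\setminus B|}{|B|}\right\},$$ the infimum being over all convex sets $K_A\supset A$, $K_B\supset B$ that are homothetic, i.e. $K_A=rK_B+v$ for some $r>0$, $v\in\mathbb R^n$. Here $\alpha$ is the Fraenkel asymmetry index and $\omega$ is the Figalli–Jerison measure. (i) For every $\tau\in(0,\tfrac12]$ there is $d_\tau>0$ such that, whenever $E,F\subset\mathbb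 R^2$ are convex sets with $0<|E|,|F|<\infty$, $t(E,F)\in[\tau,1-\tau]$ and $\delta(E,F)\le d_\tau$, one has $$\omega(E,F)\le 21\,\alpha(E,F).$$ (ii) For every $n\ge1$ and all Lebesgue measurable $A,B\subset\mathbb R^n$ with $0<|A|,|B|<\infty$, one has $\alpha(A,B)\le 2\,\omega(A,B)$. In particular, $\alpha(E,F)\le 2\,\omega(E,F)\le 42\,\alpha(E,F)$ for $E,F$ as in (i). -/

import Mathlib

open MeasureTheory
open scoped ENNReal Pointwise

/-- Normalized volume ratio `t(A,B) = |A|^(1/n) / (|A|^(1/n) + |B|^(1/n))` for `A, B ⊆ ℝⁿ`.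
The bars denote outer Lebesgue measure. (If `A` or `B` has measure `0` or `∞`, the value of this
expression is `0` or `1`, so that `t(A,B) ∈ [τ, 1 - τ]` with `τ > 0` excludes these cases.) -/
noncomputable def volumeRatio {n : ℕ} (A B : Set (EuclideanSpace ℝ (Fin n))) : ℝ :=
  (volume.real A) ^ (1 / (n : ℝ)) /
    ((volume.real A) ^ (1 / (n : ℝ)) + (volume.real B) ^ (1 / (n : ℝ)))

/-- Brunn–Minkowski deficit `δ(A,B) = |A+B|^(1/n) / (|A|^(1/n) + |B|^(1/n)) - 1`,
where `A + B` is the Minkowski sum. -/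
noncomputable def bmDeficit {n : ℕ} (A B : Set (EuclideanSpace ℝ (Fin n))) : ℝ :=
  (volume.real (A + B)) ^ (1 / (n : ℝ)) /
    ((volume.real A) ^ (1 / (n : ℝ)) + (volume.real B) ^ (1 / (n : ℝ))) - 1

/-- `K` is a translate of a positive dilate of `L`. -/
def AreHomothetic {n : ℕ} (K L : Set (EuclideanSpace ℝ (Fin n))) : Prop :=
  ∃ r : ℝ, 0 < r ∧ ∃ v : EuclideanSpace ℝ (Fin n), K = v +ᵥ r • L

/-- Fraenkel asymmetry index: the infimum over `x` of `|A ∆ (s • co B + x)| / |A|`,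
where `s > 0` satisfies `|A| = |s • co B|` (it is `∞` if there is no such `s`). -/
noncomputable def fraenkelAsymmetry {n : ℕ} (A B : Set (EuclideanSpace ℝ (Fin n))) : ℝ≥0∞ :=
  ⨅ (s : ℝ) (_ : 0 < s) (_ : volume A = volume (s • convexHull ℝ B))
    (x : EuclideanSpace ℝ (Fin n)),
    volume (symmDiff A (x +ᵥ s • convexHull ℝ B)) / volume A

/-- The Figalli–Jerison measure: the infimum, over homothetic convex sets `K ⊇ A` and `L ⊇ B`, of
`max (|K \ A| / |A|) (|L \ B| / |B|)`. -/
noncomputable def figalliJerison {n : ℕ} (A B : Set (EuclideanSpace ℝ (Fin n))) : ℝ≥0∞ :=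
  ⨅ (K : Set (EuclideanSpace ℝ (Fin n))) (L : Set (EuclideanSpace ℝ (Fin n)))
    (_ : Convex ℝ K) (_ : Convex ℝ L) (_ : AreHomothetic K L) (_ : A ⊆ K) (_ : B ⊆ L),
    max (volume (K \ A) / volume A) (volume (L \ B) / volume B)

open scoped Topology

/-! Asymmetry at most `2ω`, in any dimension. Let `K = v + rL ⊇ A` and `L ⊇ B` be competitors for
`ω`, put `C = co B ⊆ L`, and take `s` with `|sC| = |A|`. If `s ≤ r`, a translate of `sC` fits inside
`K`, so it exceeds `A` by at most `|K \ A|`. If `s > r`, a translate of `sC` contains `v + rC`, so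
`A` exceeds it by at most `r^n |L \ C|`. Since the two measures agree, the symmetric difference is
twice either one-sided difference.

Planar bound. Let `F' = x + sF` have the area of `E`, and pass to closures.

If `|E ∆ F'| ≤ (3/5)|E|`, use `K = co(E ∪ F')`. With the origin at a suitable centre of `E ∩ F'`,
the set `K \ (E ∪ F')` is covered by disjoint cones over bridges `[p, q]`, boundary segments of `K`
from `E` to `F'`. On each bridge some `x` has the same gauge `g` for both bodies. The linear map `p
↦ x/g`, `x ↦ p` has determinant `±1/g` and carries the uncovered points between the rays of `p` and
`x` into `E \ F'`; the other side is symmetric (`measure_gap_inter_openCone_le`). A Helly centre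
gives `g ≤ 10`, so the gap is at most `10 |E ∆ F'|`, and `|K \ E|`, `|K \ F'|` are at most `11 |E ∆
F'|`.

If `|E ∆ F'| > (3/5)|E|`, it suffices that `ω ≤ 11`. Slicing bounds `|E + F|` below in terms of the
widths in any direction. Small deficit then makes the widths of `sF` at most `11/10` those of `E`,
and a translate of `sF` lies in a `33/10`-dilate of `E` about its centre. The deficit is used only
in this case. -/

theorem measure_sdiff_comm_of_eq {α : Type*} {m : MeasurableSpace α} {μ : Measure α} {s t : Set α}
    (hs : NullMeasurableSet s μ) (ht : NullMeasurableSet t μ) (h : μ s = μ t) (hfin : μ t ≠ ∞) :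
    μ (s \ t) = μ (t \ s) := by
  have h1 := measure_inter_add_sdiff₀ s ht
  have h2 := measure_inter_add_sdiff₀ t hs
  rw [Set.inter_comm] at h2
  have h3 : μ (s ∩ t) ≠ ∞ := measure_ne_top_of_subset Set.inter_subset_right hfin
  rw [← h2, ← h1] at h
  exact (ENNReal.add_right_inj h3).1 h

theorem measure_symmDiff_eq_two_mul_of_eq {α : Type*} {m : MeasurableSpace α} {μ : Measure α}
    {s t : Set α} (hs : NullMeasurableSet s μ) (ht : NullMeasurableSet t μ) (h : μ s = μ t)
    (hfin : μ t ≠ ∞) : μ (symmDiff s t) = 2 * μ (s \ t) := by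
  rw [measure_symmDiff_eq hs ht, measure_sdiff_comm_of_eq ht hs h.symm (h ▸ hfin), two_mul]

/-! ### Homothets and the bound of the asymmetry by `2ω` -/

theorem smul_vadd_smul_subset {V : Type*} [AddCommGroup V] [Module ℝ V] {L : Set V}
    (hL : Convex ℝ L) {s r : ℝ} (hs : 0 ≤ s) (hsr : s ≤ r) {l : V} (hl : l ∈ L) :
    (r - s) • l +ᵥ s • L ⊆ r • L := by
  have := hL.add_smul (sub_nonneg.2 hsr) hs
  rw [sub_add_cancel] at this
  rw [this]
  rintro _ ⟨y, hy, rfl⟩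
  exact Set.add_mem_add (Set.smul_mem_smul_set hl) hy

theorem volume_vadd_smul {n : ℕ} (C : Set (EuclideanSpace ℝ (Fin n)))
    (x : EuclideanSpace ℝ (Fin n)) {s : ℝ} (hs : 0 ≤ s) :
    volume (x +ᵥ s • C) = ENNReal.ofReal (s ^ n) * volume C := by
  rw [measure_vadd, Measure.addHaar_smul_of_nonneg _ hs, finrank_euclideanSpace_fin]

theorem sdiff_vadd_smul {n : ℕ} (C D : Set (EuclideanSpace ℝ (Fin n)))
    (x : EuclideanSpace ℝ (Fin n)) {s : ℝ} (hs : 0 < s) :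
    (x +ᵥ s • C) \ (x +ᵥ s • D) = x +ᵥ s • (C \ D) := by
  rw [Set.smul_set_sdiff₀ hs.ne', Set.vadd_set_sdiff]

theorem fraenkelAsymmetry_le {n : ℕ} {A B : Set (EuclideanSpace ℝ (Fin n))} {s : ℝ} (hs : 0 < s)
    (h : volume A = volume (s • convexHull ℝ B)) (x : EuclideanSpace ℝ (Fin n)) :
    fraenkelAsymmetry A B ≤ volume (symmDiff A (x +ᵥ s • convexHull ℝ B)) / volume A :=
  iInf_le_of_le s <| iInf_le_of_le hs <| iInf_le_of_le h <| iInf_le _ x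

theorem exists_volume_eq_smul {n : ℕ} (hn : n ≠ 0) {A C : Set (EuclideanSpace ℝ (Fin n))}
    (hA0 : volume A ≠ 0) (hA : volume A ≠ ∞) (hC0 : volume C ≠ 0) (hC : volume C ≠ ∞) :
    ∃ s : ℝ, 0 < s ∧ volume A = volume (s • C) := by
  have ha := ENNReal.toReal_pos hA0 hA
  have hc := ENNReal.toReal_pos hC0 hC
  set q := (volume A).toReal / (volume C).toReal with hq
  have hq0 : 0 < q := div_pos ha hc
  refine ⟨q ^ (1 / (n : ℝ)), Real.rpow_pos_of_pos hq0 _, ?_⟩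
  have h := volume_vadd_smul C 0 (Real.rpow_nonneg hq0.le (1 / (n : ℝ)))
  rw [zero_vadd] at h
  rw [h, one_div, Real.rpow_inv_natCast_pow hq0.le hn, ← ENNReal.ofReal_toReal hA,
    ← ENNReal.ofReal_toReal hC, ← ENNReal.ofReal_mul hq0.le, hq,
    div_mul_cancel₀ _ hc.ne']

theorem exists_symmDiff_le_of_homothetic {n : ℕ} {A C L : Set (EuclideanSpace ℝ (Fin n))}
    {v : EuclideanSpace ℝ (Fin n)} {w : ℝ≥0∞} {r s : ℝ} (hr : 0 < r) (hs : 0 < s)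
    (hA : NullMeasurableSet A) (hA' : volume A ≠ ∞) (hC : Convex ℝ C) (hC' : C.Nonempty)
    (hL : Convex ℝ L) (hCL : C ⊆ L) (hAs : volume A = volume (s • C))
    (hAL : A ⊆ v +ᵥ r • L) (hwA : volume ((v +ᵥ r • L) \ A) ≤ w * volume A)
    (hwL : volume (L \ C) ≤ w * volume C) :
    ∃ x : EuclideanSpace ℝ (Fin n), volume (symmDiff A (x +ᵥ s • C)) ≤ 2 * w * volume A := by
  obtain ⟨c, hc⟩ := hC'
  have key : ∀ x : EuclideanSpace ℝ (Fin n), volume A = volume (x +ᵥ s • C) := fun x ↦ by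
    rw [measure_vadd, hAs]
  have hm : ∀ x : EuclideanSpace ℝ (Fin n), NullMeasurableSet (x +ᵥ s • C) := fun x ↦
    ((hC.smul s).vadd x).nullMeasurableSet volume
  rcases le_or_gt s r with hsr | hsr
  · refine ⟨v + (r - s) • c, ?_⟩
    rw [symmDiff_comm, measure_symmDiff_eq_two_mul_of_eq (hm _) hA (key _).symm hA', mul_assoc]
    gcongr
    refine (measure_mono (Set.sdiff_subset_sdiff_left ?_)).trans hwA
    rw [add_vadd]
    refine Set.vadd_set_mono (Set.Subset.trans ?_ (smul_vadd_smul_subset hL hs.le hsr (hCL hc)))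
    exact Set.vadd_set_mono (Set.smul_set_mono hCL)
  · refine ⟨v - (s - r) • c, ?_⟩
    rw [measure_symmDiff_eq_two_mul_of_eq hA (hm _) (key _) (key _ ▸ hA'), mul_assoc]
    gcongr
    -- The larger copy is the dilate of `v + rC` about its point `v + r • c`, so it contains that
    -- smaller copy.
    have hsub : v +ᵥ r • C ⊆ (v - (s - r) • c) +ᵥ s • C := by
      have := smul_vadd_smul_subset hC hr.le hsr.le hc
      have h2 := Set.vadd_set_mono (a := v - (s - r) • c) this
      rwa [vadd_vadd, sub_add_cancel] at h2
    calc volume (A \ ((v - (s - r) • c) +ᵥ s • C))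
        ≤ volume ((v +ᵥ r • L) \ (v +ᵥ r • C)) := measure_mono (Set.sdiff_subset_sdiff hAL hsub)
      _ = ENNReal.ofReal (r ^ n) * volume (L \ C) := by
          rw [sdiff_vadd_smul _ _ _ hr, volume_vadd_smul _ _ hr.le]
      _ ≤ ENNReal.ofReal (s ^ n) * (w * volume C) := by gcongr
      _ = w * volume A := by
          rw [key 0, volume_vadd_smul _ _ hs.le]; ring

theorem fraenkelAsymmetry_le_two_mul_figalliJerison {n : ℕ} (hn : n ≠ 0)
    {A B : Set (EuclideanSpace ℝ (Fin n))} (hA : NullMeasurableSet A)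
    (hA0 : volume A ≠ 0) (hAt : volume A ≠ ∞) (hB0 : volume B ≠ 0) (hBt : volume B ≠ ∞) :
    fraenkelAsymmetry A B ≤ 2 * figalliJerison A B := by
  -- Dividing by `2` isolates the infimum, so that competitors can be treated one at a time.
  rw [mul_comm, ← ENNReal.div_le_iff (by simp) (by simp)]
  refine le_iInf fun K ↦ le_iInf fun L ↦ le_iInf fun hK ↦ le_iInf fun hL ↦ le_iInf fun hKL ↦
    le_iInf fun hAK ↦ le_iInf fun hBL ↦ ?_
  rw [ENNReal.div_le_iff (by simp) (by simp), mul_comm]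
  obtain ⟨r, hr, v, rfl⟩ := hKL
  set w := max (volume ((v +ᵥ r • L) \ A) / volume A) (volume (L \ B) / volume B) with hw
  rcases eq_or_ne w ∞ with hwt | hwt
  · simp [hwt]
  have hwA : volume ((v +ᵥ r • L) \ A) ≤ w * volume A :=
    (ENNReal.div_le_iff hA0 hAt).1 (le_max_left _ _)
  have hwB : volume (L \ B) ≤ w * volume B := (ENNReal.div_le_iff hB0 hBt).1 (le_max_right _ _)
  have hBC := subset_convexHull ℝ B
  have hCL : convexHull ℝ B ⊆ L := convexHull_min hBL hL
  have hLt : volume L ≠ ∞ := by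
    rw [← Set.union_sdiff_cancel hBL]
    exact measure_union_ne_top hBt (ne_top_of_le_ne_top (ENNReal.mul_ne_top hwt hBt) hwB)
  have hCt : volume (convexHull ℝ B) ≠ ∞ := measure_ne_top_of_subset hCL hLt
  have hC0 : volume (convexHull ℝ B) ≠ 0 := fun h ↦ hB0 (measure_mono_null hBC h)
  obtain ⟨s, hs, hAs⟩ := exists_volume_eq_smul hn hA0 hAt hC0 hCt
  obtain ⟨x, hx⟩ := exists_symmDiff_le_of_homothetic hr hs hA hAt (convex_convexHull ℝ B)
    (nonempty_of_measure_ne_zero hC0) hL hCL hAs hAK hwA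
    ((measure_mono (Set.sdiff_subset_sdiff_right hBC)).trans (hwB.trans (by gcongr)))
  exact (fraenkelAsymmetry_le hs hAs x).trans ((ENNReal.div_le_iff hA0 hAt).2 hx)

/-! ### Compactness, boundedness and null boundaries of convex sets -/

theorem IsCompact.convexHull_union {V : Type*} [AddCommGroup V] [Module ℝ V] [TopologicalSpace V]
    [ContinuousAdd V] [ContinuousSMul ℝ V] {E F : Set V} (hE : IsCompact E) (hF : IsCompact F)
    (hEc : Convex ℝ E) (hFc : Convex ℝ F) (hE0 : E.Nonempty) (hF0 : F.Nonempty) :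
    IsCompact (convexHull ℝ (E ∪ F)) := by
  rw [_root_.convexHull_union hE0 hF0, hEc.convexHull_eq, hFc.convexHull_eq]
  have : convexJoin ℝ E F = (fun p : ℝ × V × V ↦ (1 - p.1) • p.2.1 + p.1 • p.2.2) ''
      (Set.Icc 0 1 ×ˢ E ×ˢ F) := by
    ext w
    simp only [mem_convexJoin, segment_eq_image, Set.mem_image, Prod.exists, Set.mem_prod]
    constructor
    · rintro ⟨a, ha, b, hb, t, ht, rfl⟩
      exact ⟨t, a, b, ⟨ht, ha, hb⟩, rfl⟩
    · rintro ⟨t, a, b, ⟨ht, ha, hb⟩, rfl⟩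
      exact ⟨a, ha, b, hb, t, ht, rfl⟩
  rw [this]
  exact (isCompact_Icc.prod (hE.prod hF)).image (by fun_prop)

section Haar

variable {V : Type*} [NormedAddCommGroup V] [NormedSpace ℝ V] [FiniteDimensional ℝ V]
  [MeasurableSpace V] [BorelSpace V] {μ : Measure V} [μ.IsAddHaarMeasure]

theorem Convex.interior_nonempty_of_measure_ne_zero {s : Set V} (hs : Convex ℝ s)
    (h : μ s ≠ 0) : (interior s).Nonempty := by
  by_contra h0
  rw [Set.not_nonempty_iff_eq_empty] at h0
  refine h (measure_mono_null ?_ (hs.addHaar_frontier μ))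
  rw [frontier, h0, Set.sdiff_empty]
  exact subset_closure

/-- A ball in `s` together with a far point `x` of `s` spans a long cone, which contains arbitrarily
many disjoint balls of half the radius. -/
theorem Convex.isBounded_of_measure_ne_top {s : Set V} (hs : Convex ℝ s) (h0 : μ s ≠ 0)
    (ht : μ s ≠ ∞) : Bornology.IsBounded s := by
  obtain ⟨o, ho⟩ := hs.interior_nonempty_of_measure_ne_zero h0
  obtain ⟨r, hr, hball⟩ := Metric.isOpen_iff.1 isOpen_interior o ho
  replace hball := hball.trans interior_subset
  set c := μ (Metric.ball o (r / 2)) with hc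
  have hc0 : c ≠ 0 := (Metric.measure_ball_pos μ o (half_pos hr)).ne'
  obtain ⟨N, hN⟩ := ENNReal.exists_nat_mul_gt hc0 ht
  -- At distance more than `2Nr`, the `N` centres, spaced by `r`, stay in the first half of the
  -- segment from `o` to `x`, where contraction towards `x` shrinks the ball by at most `1/2`.
  refine (Metric.isBounded_closedBall (x := o) (r := 2 * N * r)).subset fun x hx ↦ ?_
  by_contra hxo
  rw [Metric.mem_closedBall, dist_eq_norm, not_le] at hxo
  have hd : 0 < ‖x - o‖ := lt_of_le_of_lt (by positivity) hxo
  set e : V := (r / ‖x - o‖) • (x - o) with he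
  have hne : ‖e‖ = r := by
    rw [he, norm_smul, Real.norm_of_nonneg (by positivity), div_mul_cancel₀ _ hd.ne']
  have hsub : ∀ i ∈ Finset.range N, Metric.ball (o + (i : ℝ) • e) (r / 2) ⊆ s := by
    intro i hi y hy
    have hiN : (i : ℝ) ≤ N := by exact_mod_cast (Finset.mem_range.1 hi).le
    set t : ℝ := i * (r / ‖x - o‖) with ht
    have ht0 : 0 ≤ t := by positivity
    have ht1 : t ≤ 1 / 2 := by
      rw [ht, ← mul_div_assoc, div_le_iff₀ hd]
      nlinarith
    have h1 : 0 < 1 - t := by linarith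
    have hz : o + (1 - t)⁻¹ • (y - (o + (i : ℝ) • e)) ∈ s := by
      apply hball
      rw [Metric.mem_ball, dist_eq_norm] at hy ⊢
      rw [add_sub_cancel_left, norm_smul, norm_inv, Real.norm_of_nonneg h1.le,
        inv_mul_lt_iff₀ h1]
      nlinarith
    have := hs hz hx h1.le ht0 (by ring)
    convert this using 1
    rw [smul_add, smul_smul, mul_inv_cancel₀ h1.ne', he, smul_smul, ← ht]
    module
  have hdisj : (Finset.range N : Set ℕ).PairwiseDisjoint
      fun i ↦ Metric.ball (o + (i : ℝ) • e) (r / 2) := by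
    intro i _ j _ hij
    apply Metric.ball_disjoint_ball
    rw [dist_add_left, dist_eq_norm, ← sub_smul, norm_smul, hne, add_halves]
    have : (1 : ℝ) ≤ ‖(i : ℝ) - j‖ := by
      rw [Real.norm_eq_abs]
      have : (1 : ℤ) ≤ |(i : ℤ) - j| := Int.one_le_abs (by omega)
      exact_mod_cast this
    nlinarith
  have := measure_biUnion_finset hdisj (μ := μ) fun i _ ↦ Metric.isOpen_ball.measurableSet
  have hle : μ (⋃ i ∈ Finset.range N, Metric.ball (o + (i : ℝ) • e) (r / 2)) ≤ μ s :=
    measure_mono (Set.iUnion₂_subset hsub)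
  rw [this] at hle
  have hb : ∀ i ∈ Finset.range N, μ (Metric.ball (o + (i : ℝ) • e) (r / 2)) = c := fun i _ ↦ by
    rw [hc, Measure.addHaar_ball_center, ← Measure.addHaar_ball_center μ o]
  rw [Finset.sum_congr rfl hb, Finset.sum_const, Finset.card_range, nsmul_eq_mul] at hle
  exact absurd hN (not_lt.2 hle)

theorem Convex.closure_ae_eq {s : Set V} (hs : Convex ℝ s) : closure s =ᵐ[μ] s :=
  closure_ae_eq_of_null_frontier (hs.addHaar_frontier μ)

end Haar

/-! ### A centre of a planar convex body -/

/-- Helly's theorem for the sets `x/3 + (2/3)M`: any three of them share the centroid of their base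
points, since a centroid is one third of a vertex plus two thirds of the opposite midpoint. -/
theorem exists_center {V : Type*} [NormedAddCommGroup V] [NormedSpace ℝ V]
    [FiniteDimensional ℝ V] (hV : Module.finrank ℝ V = 2) {M : Set V}
    (hM : Convex ℝ M) (hMc : IsCompact M) (hM0 : M.Nonempty) :
    ∃ m, ∀ x ∈ M, m + (1 / 2 : ℝ) • (m - x) ∈ M := by
  obtain ⟨o, ho⟩ := hM0
  obtain ⟨m, hm⟩ := Convex.helly_theorem_compact' (𝕜 := ℝ)
    (F := fun x : M ↦ (fun y : V ↦ (1 / 3 : ℝ) • (x : V) + (2 / 3 : ℝ) • y) '' M)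
    (fun x ↦ hM.affinity _ _)
    (fun x ↦ hMc.image (by fun_prop)) (fun I hI ↦ by
      classical
      rw [hV] at hI
      obtain ⟨a, b, c, hIJ⟩ : ∃ a b c : M, I ⊆ {a, b, c} := by
        interval_cases h : I.card
        · exact ⟨⟨o, ho⟩, ⟨o, ho⟩, ⟨o, ho⟩, by simp [Finset.card_eq_zero.1 h]⟩
        · obtain ⟨a, rfl⟩ := Finset.card_eq_one.1 h
          exact ⟨a, a, a, by simp⟩
        · obtain ⟨a, b, -, rfl⟩ := Finset.card_eq_two.1 h
          exact ⟨a, b, b, by simp⟩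
        · obtain ⟨a, b, c, -, -, -, rfl⟩ := Finset.card_eq_three.1 h
          exact ⟨a, b, c, subset_rfl⟩
      have hmid : ∀ y z : M, (1 / 2 : ℝ) • (y : V) + (1 / 2 : ℝ) • (z : V) ∈ M := fun y z ↦
        hM y.2 z.2 (by norm_num) (by norm_num) (by norm_num)
      refine ⟨(1 / 3 : ℝ) • ((a : V) + b + c), Set.mem_iInter₂.2 fun x hx ↦ ?_⟩
      have hx := hIJ hx
      simp only [Finset.mem_insert, Finset.mem_singleton] at hx
      rcases hx with rfl | rfl | rfl
      · exact ⟨_, hmid b c, by module⟩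
      · exact ⟨_, hmid a c, by module⟩
      · exact ⟨_, hmid a b, by module⟩)
  refine ⟨m, fun x hx ↦ ?_⟩
  obtain ⟨y, hy, hxy⟩ := Set.mem_iInter.1 hm ⟨x, hx⟩
  convert hy using 1
  simp only at hxy
  rw [← hxy]
  module

theorem center_mem_interior {V : Type*} [NormedAddCommGroup V] [NormedSpace ℝ V] {M : Set V}
    (hM : Convex ℝ M) (hM0 : (interior M).Nonempty) {m : V}
    (hm : ∀ x ∈ M, m + (1 / 2 : ℝ) • (m - x) ∈ M) : m ∈ interior M := by
  obtain ⟨o, ho⟩ := hM0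
  have := hM.combo_interior_self_mem_interior ho (hm o (interior_subset ho))
    (a := 1 / 3) (b := 2 / 3) (by norm_num) (by norm_num) (by norm_num)
  convert this using 1
  module

/-- If the contracted point is separated from `M` by `f < u`, with `f m = 0` say, then `f k > 10u`,
while the centre property gives `f > -2u` on `M`. Hence `f > u` on `k/4 + (3/4)M`, a subset of `E \
M` of measure `(9/16) μ M`. -/
theorem homothety_center_mem {V : Type*} [NormedAddCommGroup V] [NormedSpace ℝ V]
    [MeasurableSpace V] [BorelSpace V] {μ : Measure V} [μ.IsAddHaarMeasure]
    (hV : Module.finrank ℝ V = 2) {M E : Set V} (hM : Convex ℝ M) (hMc : IsClosed M)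
    (hE : Convex ℝ E) (hME : M ⊆ E) {m : V} (hm : ∀ x ∈ M, m + (1 / 2 : ℝ) • (m - x) ∈ M)
    (hμ : μ (E \ M) < ENNReal.ofReal (9 / 16) * μ M) {k : V} (hk : k ∈ E) :
    m + (1 / 10 : ℝ) • (k - m) ∈ M := by
  have : FiniteDimensional ℝ V := Module.finite_of_finrank_eq_succ hV
  by_contra hkM
  obtain ⟨f, u, hfu, huf⟩ := geometric_hahn_banach_closed_point hM hMc hkM
  refine hμ.not_ge ?_
  have h916 : μ ((1 / 4 : ℝ) • k +ᵥ (3 / 4 : ℝ) • M) = ENNReal.ofReal (9 / 16) * μ M := by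
    rw [measure_vadd, Measure.addHaar_smul_of_nonneg _ (by norm_num), hV]
    norm_num
  rw [← h916]
  refine measure_mono ?_
  rintro _ ⟨_, ⟨x, hx, rfl⟩, rfl⟩
  refine ⟨hE hk (hME hx) (by norm_num) (by norm_num) (by norm_num), fun hmem ↦ ?_⟩
  have h1 := hfu _ hmem
  have h2 := hfu _ (hm x hx)
  simp only [vadd_eq_add, map_add, map_smul, map_sub, smul_eq_mul] at h1 h2 huf
  linarith

/-! ### The gap between two bodies and their convex hull -/

/-- The relatively open convex cone spanned by two vectors. -/
def openCone {V : Type*} [AddCommGroup V] [Module ℝ V] (p q : V) : Set V :=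
  {w | ∃ a b : ℝ, 0 < a ∧ 0 < b ∧ w = a • p + b • q}

/-- `[p, q]` is a segment on the boundary of `K` that joins `E` to `F` through the complement of
`E ∪ F`. -/
def IsGapEdge {V : Type*} [AddCommGroup V] [Module ℝ V] [TopologicalSpace V]
    (E F K : Set V) (p q : V) : Prop :=
  p ∈ E ∧ q ∈ F ∧ (∃ l : V →L[ℝ] ℝ, l p = 1 ∧ l q = 1 ∧ ∀ w ∈ K, l w ≤ 1) ∧
    ∀ u ∈ Set.Ioo (0 : ℝ) 1, AffineMap.lineMap p q u ∉ E ∧ AffineMap.lineMap p q u ∉ F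

theorem linearIndependent_pair_of_eq_one {V : Type*} [AddCommGroup V] [Module ℝ V] {p q : V}
    (l : V →ₗ[ℝ] ℝ) (hp : l p = 1) (hq : l q = 1) (hpq : p ≠ q) :
    LinearIndependent ℝ ![p, q] := by
  rw [LinearIndependent.pair_iff]
  intro s t hst
  have h := congrArg l hst
  simp only [map_add, map_smul, hp, hq, smul_eq_mul, mul_one, map_zero] at h
  obtain rfl : t = -s := by linarith
  have : s • (p - q) = 0 := by rw [← hst]; module
  rcases smul_eq_zero.1 this with rfl | h
  · simp
  · exact absurd (sub_eq_zero.1 h) hpq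

theorem exists_basis_pair {V : Type*} [AddCommGroup V] [Module ℝ V]
    (hV : Module.finrank ℝ V = 2) {p q : V} (h : LinearIndependent ℝ ![p, q]) :
    ∃ b : Module.Basis (Fin 2) ℝ V, b 0 = p ∧ b 1 = q :=
  ⟨basisOfLinearIndependentOfCardEqFinrank h (by simp [hV]), by simp, by simp⟩

section

variable {V : Type*} [NormedAddCommGroup V] [NormedSpace ℝ V]

theorem isOpen_openCone (hV : Module.finrank ℝ V = 2) {p q : V}
    (h : LinearIndependent ℝ ![p, q]) : IsOpen (openCone p q) := by
  have : FiniteDimensional ℝ V := Module.finite_of_finrank_eq_succ hV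
  obtain ⟨b, rfl, rfl⟩ := exists_basis_pair hV h
  have : openCone (b 0) (b 1) = {w | 0 < b.coord 0 w} ∩ {w | 0 < b.coord 1 w} := by
    ext w
    constructor
    · rintro ⟨s, t, hs, ht, rfl⟩
      simp [hs, ht]
    · rintro ⟨hs, ht⟩
      refine ⟨_, _, hs, ht, ?_⟩
      conv_lhs => rw [← b.sum_repr w, Fin.sum_univ_two]
      rfl
  rw [this]
  exact (isOpen_lt continuous_const (LinearMap.continuous_of_finiteDimensional _)).inter
    (isOpen_lt continuous_const (LinearMap.continuous_of_finiteDimensional _))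

theorem gauge_combo_le {E : Set V} (hE : Convex ℝ E) (hE0 : E ∈ 𝓝 0) {a b : ℝ} (ha : 0 ≤ a)
    (hb : 0 ≤ b) (x y : V) : gauge E (a • x + b • y) ≤ a * gauge E x + b * gauge E y := by
  have := gauge_add_le hE (absorbent_nhds_zero hE0) (a • x) (b • y)
  rwa [gauge_smul_of_nonneg ha, gauge_smul_of_nonneg hb] at this

theorem gauge_le_one_iff_mem {E : Set V} (hE : Convex ℝ E) (hE0 : E ∈ 𝓝 0) (hEc : IsClosed E)
    {x : V} : gauge E x ≤ 1 ↔ x ∈ E := by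
  rw [gauge_le_one_iff_mem_closure hE hE0, hEc.closure_eq]

/-- The map `ψ` with `p ↦ x/g`, `x ↦ p` satisfies `ψ² = 1/g`, so it scales area by `1/g`; it sends
`K \ E` into `E \ F` within the cone. -/
theorem measure_gap_inter_openCone_le [MeasurableSpace V] [BorelSpace V] {μ : Measure V}
    [μ.IsAddHaarMeasure] (hV : Module.finrank ℝ V = 2) {E F K : Set V} (hE : Convex ℝ E)
    (hF : Convex ℝ F) (hE0 : E ∈ 𝓝 0) (hF0 : F ∈ 𝓝 0) (hEc : IsClosed E) (hFc : IsClosed F)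
    {p q x : V} (hp : p ∈ E) (hq : q ∈ F) {l : V →L[ℝ] ℝ} (hlp : l p = 1) (hlx : l x = 1)
    (hlK : ∀ w ∈ K, l w ≤ 1) (hpx : p ≠ x) {s t : ℝ} (hs : 0 < s) (ht : 0 < t)
    (hst : s + t = 1)    (hx : x = s • p + t • q) {g : ℝ} (hg : 1 ≤ g) (hgE : gauge E x = g)
    (hgF : gauge F x = g) :
    μ ((K \ E) ∩ openCone p x) ≤ ENNReal.ofReal g * μ ((E \ F) ∩ openCone p x) := by
  have : FiniteDimensional ℝ V := Module.finite_of_finrank_eq_succ hV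
  have hg0 : 0 < g := one_pos.trans_le hg
  obtain ⟨b, hb0, hb1⟩ :=
    exists_basis_pair hV (linearIndependent_pair_of_eq_one (l : V →ₗ[ℝ] ℝ) hlp hlx hpx)
  set ψ : V →ₗ[ℝ] V := b.constr ℝ ![g⁻¹ • x, p] with hψ
  have hψp : ψ p = g⁻¹ • x := by rw [← hb0, hψ, Module.Basis.constr_basis]; rfl
  have hψx : ψ x = p := by rw [← hb1, hψ, Module.Basis.constr_basis]; rfl
  have hψψ : ψ ∘ₗ ψ = g⁻¹ • LinearMap.id := by
    refine b.ext fun i ↦ ?_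
    fin_cases i
    · simp [hb0, hψp, hψx]
    · simp [hb1, hψp, hψx]
  have hdet : |LinearMap.det ψ| = g⁻¹ := by
    have h := congrArg LinearMap.det hψψ
    rw [LinearMap.det_comp, LinearMap.det_smul, LinearMap.det_id, mul_one, hV, ← sq] at h
    rw [← abs_of_pos (inv_pos.2 hg0)]
    exact (sq_eq_sq_iff_abs_eq_abs _ _).1 h
  have hsub : ψ '' ((K \ E) ∩ openCone p x) ⊆ (E \ F) ∩ openCone p x := by
    rintro _ ⟨_, ⟨⟨hwK, hwE⟩, α, β, hα, hβ, rfl⟩, rfl⟩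
    have h1 := hlK _ hwK
    rw [map_add, map_smul, map_smul, hlp, hlx, smul_eq_mul, smul_eq_mul, mul_one, mul_one] at h1
    have hgp := (gauge_le_one_iff_mem hE hE0 hEc).2 hp
    have hgq := (gauge_le_one_iff_mem hF hF0 hFc).2 hq
    -- For `w = αp + βx`, lying in `K` gives `α + β ≤ 1` and lying outside `E` gives `α + βg > 1`.
    have h2 : 1 < α + β * g := by
      by_contra! h
      refine hwE ((gauge_le_one_iff_mem hE hE0 hEc).1 ?_)
      have := gauge_combo_le hE hE0 hα.le hβ.le p x
      rw [hgE] at this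
      nlinarith
    have heq : ψ (α • p + β • x) = β • p + (α / g) • x := by
      rw [map_add, map_smul, map_smul, hψp, hψx, smul_smul, add_comm, div_eq_mul_inv]
    rw [heq]
    have hαg : 0 < α / g := div_pos hα hg0
    refine ⟨⟨(gauge_le_one_iff_mem hE hE0 hEc).1 ?_, fun hwF ↦ ?_⟩, β, α / g, hβ, hαg, rfl⟩
    · have := gauge_combo_le hE hE0 hβ.le hαg.le p x
      rw [hgE, div_mul_cancel₀ _ hg0.ne'] at this
      nlinarith
    · have hw1 := (gauge_le_one_iff_mem hF hF0 hFc).2 hwF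
      have h3 := gauge_combo_le hF hF0 hs.le (mul_pos ht hβ).le (β • p + (α / g) • x) q
      -- If `ψ w` were in `F`, this multiple of `x` would have gauge at most `s + tβ`. Its gauge is
      -- `βg + sα`, which exceeds `s + tβg`, contradicting `g ≥ 1`.
      have h4 : s • (β • p + (α / g) • x) + (t * β) • q = (β + s * (α / g)) • x := by
        have : (β + s * (α / g)) • x = β • (s • p + t • q) + (s * (α / g)) • x := by
          rw [← hx]; module
        rw [this]; module
      rw [h4, gauge_smul_of_nonneg (by positivity), hgF, smul_eq_mul] at h3
      have h5 : (β + s * (α / g)) * g = β * g + s * α := by field_simp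
      rw [h5] at h3
      have h6 : s * gauge F (β • p + (α / g) • x) ≤ s := by nlinarith
      have h7 : t * β * gauge F q ≤ t * β := by nlinarith [mul_pos ht hβ]
      have h8 : s * (1 - β * g) < s * α := by gcongr; linarith
      have h9 : 0 ≤ t * β * (g - 1) := by have := sub_nonneg.2 hg; positivity
      obtain rfl : s = 1 - t := by linarith
      nlinarith
  have hvol := measure_mono (μ := μ) hsub
  rw [Measure.addHaar_image_linearMap, hdet] at hvol
  calc μ ((K \ E) ∩ openCone p x)
      = ENNReal.ofReal g * (ENNReal.ofReal g⁻¹ * μ ((K \ E) ∩ openCone p x)) := by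
        rw [← mul_assoc, ← ENNReal.ofReal_mul hg0.le, mul_inv_cancel₀ hg0.ne',
          ENNReal.ofReal_one, one_mul]
    _ ≤ _ := by gcongr

theorem IsGapEdge.symm {E F K : Set V} {p q : V} (h : IsGapEdge E F K p q) :
    IsGapEdge F E K q p := by
  obtain ⟨hp, hq, ⟨l, hlp, hlq, hl⟩, h⟩ := h
  refine ⟨hq, hp, ⟨l, hlq, hlp, hl⟩, fun u hu ↦ ?_⟩
  rw [← AffineMap.lineMap_apply_one_sub]
  exact (h (1 - u) ⟨by linarith [hu.2], by linarith [hu.1]⟩).symm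

theorem IsGapEdge.left_notMem {E F K : Set V} (hF : Convex ℝ F) {p q : V}
    (h : IsGapEdge E F K p q) : p ∉ F := fun hp ↦
  (h.2.2.2 (1 / 2) (by norm_num)).2 (hF.lineMap_mem hp h.2.1 (by norm_num))

theorem IsGapEdge.ne {E F K : Set V} (hF : Convex ℝ F) {p q : V}
    (h : IsGapEdge E F K p q) : p ≠ q := fun hpq ↦
  h.left_notMem hF (hpq ▸ h.2.1)

/-- Intermediate value theorem: the gauge of `E` is the smaller at `p`, that of `F` at `q`. -/
theorem IsGapEdge.exists_gauge_eq {E F K : Set V} (hE : Convex ℝ E)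
    (hF : Convex ℝ F) (hE0 : E ∈ 𝓝 0) (hF0 : F ∈ 𝓝 0) (hEc : IsClosed E) (hFc : IsClosed F)
    {p q : V} (h : IsGapEdge E F K p q) :
    ∃ t ∈ Set.Ioo (0 : ℝ) 1,
      gauge E (AffineMap.lineMap p q t) = gauge F (AffineMap.lineMap p q t) := by
  have hcont : ContinuousOn (fun t : ℝ ↦ gauge E (AffineMap.lineMap p q t) -
      gauge F (AffineMap.lineMap p q t)) (Set.Icc 0 1) :=
    (((continuous_gauge hE hE0).comp AffineMap.lineMap_continuous).sub
      ((continuous_gauge hF hF0).comp AffineMap.lineMap_continuous)).continuousOn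
  have hp := (gauge_le_one_iff_mem hE hE0 hEc).2 h.1
  have hq := (gauge_le_one_iff_mem hF hF0 hFc).2 h.2.1
  have hp' := mt (gauge_le_one_iff_mem hF hF0 hFc).1 (h.left_notMem hF)
  have hq' := mt (gauge_le_one_iff_mem hE hE0 hEc).1 (h.symm.left_notMem hE)
  obtain ⟨t, ht, h0⟩ := intermediate_value_Ioo zero_le_one hcont
    (show (0 : ℝ) ∈ Set.Ioo _ _ by
      simp only [AffineMap.lineMap_apply_zero, AffineMap.lineMap_apply_one]
      constructor <;> linarith)
  exact ⟨t, ht, sub_eq_zero.1 h0⟩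

theorem openCone_comm (p q : V) : openCone p q = openCone q p := by
  ext w
  constructor <;> rintro ⟨a, b, ha, hb, rfl⟩ <;> exact ⟨b, a, hb, ha, add_comm _ _⟩

theorem openCone_combo_subset {p q : V} {s t : ℝ} (hs : 0 < s) (ht : 0 < t) :
    openCone p (s • p + t • q) ⊆ openCone p q := by
  rintro _ ⟨a, b, ha, hb, rfl⟩
  exact ⟨a + b * s, b * t, by positivity, by positivity, by module⟩

theorem openCone_subset_union {p q : V} {s t : ℝ} (hs : 0 < s) (ht : 0 < t) :
    openCone p q ⊆ openCone p (s • p + t • q) ∪ openCone q (s • p + t • q) ∪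
      (ℝ ∙ (s • p + t • q) : Submodule ℝ V) := by
  rintro _ ⟨a, b, ha, hb, rfl⟩
  rcases lt_trichotomy (a * t) (b * s) with h | h | h
  · refine Or.inl (Or.inr ⟨b - a * t / s, a / s, ?_, by positivity, ?_⟩)
    · rw [sub_pos, div_lt_iff₀ hs]; exact h
    · match_scalars <;> field_simp
      ring
  · refine Or.inr (Submodule.mem_span_singleton.2 ⟨a / s, ?_⟩)
    match_scalars <;> field_simp
    linarith
  · refine Or.inl (Or.inl ⟨a - b * s / t, b / t, ?_, by positivity, ?_⟩)
    · rw [sub_pos, div_lt_iff₀ ht]; exact h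
    · match_scalars <;> field_simp
      ring

/-- The ray through the point of equal gauges is null and cuts the cone in two; the half at `p` is
charged to `E \ F` and the half at `q` to `F \ E`. -/
theorem IsGapEdge.measure_gap_inter_le [MeasurableSpace V] [BorelSpace V] {μ : Measure V}
    [μ.IsAddHaarMeasure] (hV : Module.finrank ℝ V = 2) {E F K : Set V} (hE : Convex ℝ E)
    (hF : Convex ℝ F) (hK : Convex ℝ K) (hE0 : E ∈ 𝓝 0) (hF0 : F ∈ 𝓝 0) (hEc : IsClosed E)
    (hFc : IsClosed F) (hEK : E ⊆ K) (hFK : F ⊆ K) {C : ℝ} (hC : ∀ w ∈ K, gauge E w ≤ C)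
    {p q : V} (h : IsGapEdge E F K p q) :
    μ ((K \ (E ∪ F)) ∩ openCone p q) ≤ ENNReal.ofReal C * μ (symmDiff E F ∩ openCone p q) := by
  have : FiniteDimensional ℝ V := Module.finite_of_finrank_eq_succ hV
  obtain ⟨t, ht, hgt⟩ := h.exists_gauge_eq hE hF hE0 hF0 hEc hFc
  have hpq := h.ne hF
  obtain ⟨hp, hq, ⟨l, hlp, hlq, hl⟩, hout⟩ := h
  have hs : 0 < 1 - t := sub_pos.2 ht.2
  have hx : (AffineMap.lineMap p q t : V) = (1 - t) • p + t • q :=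
    AffineMap.lineMap_apply_module _ _ _
  have hxK : (AffineMap.lineMap p q t : V) ∈ K :=
    hK.lineMap_mem (hEK hp) (hFK hq) ⟨ht.1.le, ht.2.le⟩
  have hgC := hC _ hxK
  have hxE := mt (gauge_le_one_iff_mem hE hE0 hEc).1 (hout t ht).1
  rw [hx] at hgt hxE hgC
  set x := (1 - t) • p + t • q with hxdef
  have hlx : l x = 1 := by rw [hxdef]; simp [hlp, hlq]
  have hpx : p ≠ x := fun hpx ↦ hpq <| by
    have : t • (p - q) = 0 := by
      calc t • (p - q) = p - x := by rw [hxdef]; module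
        _ = 0 := sub_eq_zero.2 hpx
    exact sub_eq_zero.1 ((smul_eq_zero.1 this).resolve_left ht.1.ne')
  have hqx : q ≠ x := fun hqx ↦ hpq <| by
    have : (1 - t) • (p - q) = 0 := by
      calc (1 - t) • (p - q) = x - q := by rw [hxdef]; module
        _ = 0 := sub_eq_zero.2 hqx.symm
    exact sub_eq_zero.1 ((smul_eq_zero.1 this).resolve_left hs.ne')
  have hg1 : 1 ≤ gauge E x := (not_le.1 hxE).le
  have h1 := measure_gap_inter_openCone_le (μ := μ) hV hE hF hE0 hF0 hEc hFc hp hq hlp hlx hl hpx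
    hs ht.1 (by ring) hxdef hg1 rfl hgt.symm
  have h2 := measure_gap_inter_openCone_le (μ := μ) hV hF hE hF0 hE0 hFc hEc hq hp hlq hlx hl hqx
    ht.1 hs (by ring) (hxdef.trans (add_comm _ _)) hg1 hgt.symm rfl
  have hspan : μ (ℝ ∙ x : Submodule ℝ V) = 0 := by
    refine Measure.addHaar_submodule μ _ fun htop ↦ ?_
    have := finrank_span_singleton (K := ℝ) (v := x) (by rintro h0; simp [h0] at hlx)
    rw [htop, finrank_top, hV] at this
    omega
  have hmono : ENNReal.ofReal (gauge E x) ≤ ENNReal.ofReal C := ENNReal.ofReal_le_ofReal hgC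
  have hcover : (K \ (E ∪ F)) ∩ openCone p q ⊆ ((K \ E) ∩ openCone p x) ∪
      ((K \ F) ∩ openCone q x) ∪ (ℝ ∙ x : Submodule ℝ V) := by
    rintro w ⟨⟨hwK, hw⟩, hwc⟩
    rw [Set.mem_union, not_or] at hw
    rcases openCone_subset_union hs ht.1 hwc with (h | h) | h
    · exact Or.inl (Or.inl ⟨⟨hwK, hw.1⟩, h⟩)
    · exact Or.inl (Or.inr ⟨⟨hwK, hw.2⟩, h⟩)
    · exact Or.inr h
  have hsub1 : openCone p x ⊆ openCone p q := openCone_combo_subset hs ht.1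
  have hsub2 : openCone q x ⊆ openCone p q := by
    rw [openCone_comm p q, hxdef, add_comm]
    exact openCone_combo_subset ht.1 hs
  calc μ ((K \ (E ∪ F)) ∩ openCone p q)
      ≤ μ ((K \ E) ∩ openCone p x) + μ ((K \ F) ∩ openCone q x) + 0 := by
        rw [← hspan]
        exact (measure_mono hcover).trans ((measure_union_le _ _).trans
          (by gcongr; exact measure_union_le _ _))
    _ ≤ ENNReal.ofReal C * μ ((E \ F) ∩ openCone p q) +
        ENNReal.ofReal C * μ ((F \ E) ∩ openCone p q) := by
        rw [add_zero]
        exact add_le_add (h1.trans (by gcongr)) (h2.trans (by gcongr))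
    _ = ENNReal.ofReal C * μ (symmDiff E F ∩ openCone p q) := by
        have hmeas : MeasurableSet ((F \ E) ∩ openCone p q) :=
          (hFc.measurableSet.diff hEc.measurableSet).inter (isOpen_openCone hV
            (linearIndependent_pair_of_eq_one (l : V →ₗ[ℝ] ℝ) hlp hlq hpq)).measurableSet
        rw [← mul_add, ← measure_union _ hmeas, ← Set.union_inter_distrib_right]
        · rfl
        · exact (disjoint_sdiff_sdiff).mono Set.inter_subset_left Set.inter_subset_left

/-- Evaluating both supporting functionals at `w` forces the two edges onto one line. That line
meets `E` and `F` in disjoint intervals, and only one gap lies between them. -/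
theorem IsGapEdge.eq_of_mem_openCone (hV : Module.finrank ℝ V = 2) {E F K : Set V}
    (hE : Convex ℝ E) (hF : Convex ℝ F) (hEK : E ⊆ K) (hFK : F ⊆ K)
    {p q p' q' w : V} (h : IsGapEdge E F K p q) (h' : IsGapEdge E F K p' q')
    (hw : w ∈ openCone p q) (hw' : w ∈ openCone p' q') : p = p' ∧ q = q' := by
  have hpq := h.ne hF
  obtain ⟨hp, hq, ⟨l, hlp, hlq, hl⟩, hout⟩ := h
  obtain ⟨hp', hq', ⟨l', hlp', hlq', hl'⟩, hout'⟩ := h'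
  obtain ⟨b, hb0, hb1⟩ :=
    exists_basis_pair hV (linearIndependent_pair_of_eq_one (l : V →ₗ[ℝ] ℝ) hlp hlq hpq)
  have hline : ∀ y, l y = 1 → ∃ u : ℝ, y = AffineMap.lineMap p q u := by
    intro y hy
    have hsum := b.sum_repr y
    rw [Fin.sum_univ_two, hb0, hb1] at hsum
    refine ⟨b.repr y 1, ?_⟩
    have h1 := congrArg l hsum
    simp only [map_add, map_smul, hlp, hlq, smul_eq_mul, mul_one, hy] at h1
    rw [AffineMap.lineMap_apply_module, ← h1, add_sub_cancel_right]
    exact hsum.symm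
  obtain ⟨α, β, hα, hβ, rfl⟩ := hw
  obtain ⟨α', β', hα', hβ', hww⟩ := hw'
  have hpK := hl _ (hEK hp')
  have hqK := hl _ (hFK hq')
  have hpK' := hl' _ (hEK hp)
  have hqK' := hl' _ (hFK hq)
  have e1 := congrArg l hww
  have e2 := congrArg l' hww
  simp only [map_add, map_smul, hlp, hlq, hlp', hlq', smul_eq_mul, mul_one] at e1 e2
  have hp1 : l p' = 1 := by nlinarith
  have hq1 : l q' = 1 := by nlinarith
  obtain ⟨u', rfl⟩ := hline _ hp1
  obtain ⟨v', rfl⟩ := hline _ hq1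
  have hSE := (hE.affine_preimage (AffineMap.lineMap p q)).ordConnected
  have hSF := (hF.affine_preimage (AffineMap.lineMap p q)).ordConnected
  have h0E : (0 : ℝ) ∈ AffineMap.lineMap p q ⁻¹' E := by simpa using hp
  have h1F : (1 : ℝ) ∈ AffineMap.lineMap p q ⁻¹' F := by simpa using hq
  obtain ⟨hmE, hmF⟩ := hout (1 / 2) (by norm_num)
  have hu : u' < 1 / 2 := not_le.1 fun h ↦ hmE (hSE.out h0E hp' ⟨by norm_num, h⟩)
  have hv : 1 / 2 < v' := not_le.1 fun h ↦ hmF (hSF.out hq' h1F ⟨h, by norm_num⟩)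
  have hbetween : ∀ y, u' < y → y < v' →
      AffineMap.lineMap p q y ∉ E ∧ AffineMap.lineMap p q y ∉ F := fun y h1 h2 ↦ by
    have hd : 0 < v' - u' := by linarith
    have := hout' ((y - u') / (v' - u'))
      ⟨div_pos (by linarith) hd, (div_lt_one hd).2 (by linarith)⟩
    rwa [← AffineMap.apply_lineMap, AffineMap.lineMap_apply u' v', vsub_eq_sub, vadd_eq_add,
      smul_eq_mul, div_mul_cancel₀ _ hd.ne', sub_add_cancel] at this
  have hu0 : u' = 0 := by
    refine le_antisymm (not_lt.1 fun h ↦ (hout u' ⟨h, by linarith⟩).1 hp') (not_lt.1 fun h ↦ ?_)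
    exact (hbetween 0 h (by linarith)).1 h0E
  have hv1 : v' = 1 := by
    refine le_antisymm (not_lt.1 fun h ↦ ?_) (not_lt.1 fun h ↦ (hout v' ⟨by linarith, h⟩).2 hq')
    exact (hbetween 1 (by linarith) h).2 h1F
  simp [hu0, hv1]

theorem exists_supporting_functional {K : Set V} (hK : Convex ℝ K) (hK0 : K ∈ 𝓝 0) {w : V}
    (hw : gauge K w = 1) : ∃ l : V →L[ℝ] ℝ, l w = 1 ∧ ∀ y ∈ K, l y ≤ 1 := by
  have hwi : w ∉ interior K := fun h ↦ by
    have := (gauge_lt_one_iff_mem_interior hK hK0).2 h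
    linarith
  obtain ⟨f, hf⟩ := geometric_hahn_banach_open_point hK.interior isOpen_interior hwi
  have hfw : 0 < f w := by simpa using hf 0 (mem_interior_iff_mem_nhds.2 hK0)
  refine ⟨(f w)⁻¹ • f, by simp [hfw.ne'], fun y hy ↦ ?_⟩
  rw [smul_apply, smul_eq_mul, inv_mul_eq_div, div_le_one hfw]
  by_contra! h
  have hfy := hfw.trans h
  have hr : f w / f y < 1 := (div_lt_one hfy).2 h
  have hr0 : 0 ≤ f w / f y := by positivity
  have hlt := hf ((f w / f y) • y) <| (gauge_lt_one_iff_mem_interior hK hK0).1 <| by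
    rw [gauge_smul_of_nonneg hr0, smul_eq_mul]
    nlinarith [gauge_le_one_of_mem hy]
  rw [map_smul, smul_eq_mul, div_mul_cancel₀ _ hfy.ne'] at hlt
  exact lt_irrefl _ hlt

/-- Push `w` radially to the boundary of `K`. The point reached lies on a segment from `E` to `F`,
which a supporting line at that point must contain; trim the segment to the last point of `E` before
it and the first point of `F` after it. -/
theorem exists_isGapEdge {E F : Set V} (hE : Convex ℝ E) (hF : Convex ℝ F) (hEc : IsCompact E)
    (hFc : IsCompact F) (hE0 : E ∈ 𝓝 0) (hF0 : F ∈ 𝓝 0) {w : V}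
    (hw : w ∈ convexHull ℝ (E ∪ F) \ (E ∪ F)) :
    ∃ p q, IsGapEdge E F (convexHull ℝ (E ∪ F)) p q ∧ w ∈ openCone p q := by
  set K := convexHull ℝ (E ∪ F) with hKdef
  have hK : Convex ℝ K := convex_convexHull ℝ _
  have hEK : E ⊆ K := Set.subset_union_left.trans (subset_convexHull ℝ _)
  have hFK : F ⊆ K := Set.subset_union_right.trans (subset_convexHull ℝ _)
  have hEne : E.Nonempty := ⟨0, mem_of_mem_nhds hE0⟩
  have hFne : F.Nonempty := ⟨0, mem_of_mem_nhds hF0⟩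
  have hKc : IsCompact K := hEc.convexHull_union hFc hE hF hEne hFne
  have hK0 : K ∈ 𝓝 0 := Filter.mem_of_superset hE0 hEK
  obtain ⟨hwK, hwEF⟩ := hw
  rw [Set.mem_union, not_or] at hwEF
  have hw0 : w ≠ 0 := by rintro rfl; exact hwEF.1 (mem_of_mem_nhds hE0)
  set c := gauge K w with hc
  have hc0 : 0 < c :=
    (gauge_pos (absorbent_nhds_zero hK0) ((NormedSpace.isVonNBounded_iff ℝ).2 hKc.isBounded)).2 hw0
  have hc1 : c ≤ 1 := gauge_le_one_of_mem hwK
  have hg1 : gauge K (c⁻¹ • w) = 1 := by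
    rw [gauge_smul_of_nonneg (inv_nonneg.2 hc0.le), ← hc, smul_eq_mul, inv_mul_cancel₀ hc0.ne']
  obtain ⟨l, hlw, hl⟩ := exists_supporting_functional hK hK0 hg1
  have hw1K : c⁻¹ • w ∈ K := (gauge_le_one_iff_mem hK hK0 hKc.isClosed).1 hg1.le
  have hnot : ∀ {A : Set V}, Convex ℝ A → A ∈ 𝓝 0 → w ∉ A → c⁻¹ • w ∉ A := by
    intro A hA hA0 hwA h
    refine hwA ?_
    have := hA.smul_mem_of_zero_mem (mem_of_mem_nhds hA0) h ⟨hc0.le, hc1⟩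
    rwa [smul_inv_smul₀ hc0.ne'] at this
  have hw1E := hnot hE hE0 hwEF.1
  have hw1F := hnot hF hF0 hwEF.2
  rw [hKdef, convexHull_union hEne hFne, hE.convexHull_eq, hF.convexHull_eq,
    mem_convexJoin] at hw1K
  obtain ⟨p, hp, q, hq, hpq⟩ := hw1K
  rw [segment_eq_image_lineMap] at hpq
  obtain ⟨u, hu, huw⟩ := hpq
  have hcont : Continuous (AffineMap.lineMap p q : ℝ → V) := AffineMap.lineMap_continuous
  obtain ⟨a, ⟨haE, ha⟩, hamax⟩ := ((isCompact_Icc (a := (0 : ℝ)) (b := u)).inter_left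
    (hEc.isClosed.preimage hcont)).exists_isGreatest ⟨0, by simpa using hp, le_rfl, hu.1⟩
  obtain ⟨b, ⟨hbF, hb⟩, hbmin⟩ := ((isCompact_Icc (a := u) (b := (1 : ℝ))).inter_left
    (hFc.isClosed.preimage hcont)).exists_isLeast ⟨1, by simpa using hq, hu.2, le_rfl⟩
  have hSE := (hE.affine_preimage (AffineMap.lineMap p q)).ordConnected
  have hSF := (hF.affine_preimage (AffineMap.lineMap p q)).ordConnected
  have h0E : (0 : ℝ) ∈ AffineMap.lineMap p q ⁻¹' E := by simpa using hp
  have h1F : (1 : ℝ) ∈ AffineMap.lineMap p q ⁻¹' F := by simpa using hq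
  have huE : u ∉ AffineMap.lineMap p q ⁻¹' E := by rwa [Set.mem_preimage, huw]
  have huF : u ∉ AffineMap.lineMap p q ⁻¹' F := by rwa [Set.mem_preimage, huw]
  have hau : a < u := lt_of_le_of_ne ha.2 fun h ↦ huE (h ▸ haE)
  have hub : u < b := lt_of_le_of_ne hb.1 fun h ↦ huF (h ▸ hbF)
  have hlpq : l p = 1 ∧ l q = 1 := by
    have h1 := hl _ (hEK hp)
    have h2 := hl _ (hFK hq)
    have h3 : (1 - u) * l p + u * l q = 1 := by
      rw [← huw, AffineMap.lineMap_apply_module] at hlw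
      simpa using hlw
    have : 0 < u := lt_of_le_of_lt ha.1 hau
    have : u < 1 := lt_of_lt_of_le hub hb.2
    constructor <;> nlinarith
  have hlline : ∀ y : ℝ, l (AffineMap.lineMap p q y) = 1 := fun y ↦ by
    rw [AffineMap.lineMap_apply_module]; simp [hlpq]
  have hdab : 0 < b - a := by linarith
  refine ⟨AffineMap.lineMap p q a, AffineMap.lineMap p q b,
    ⟨haE, hbF, ⟨l, hlline a, hlline b, hl⟩, fun y hy ↦ ?_⟩, ?_⟩
  · rw [← AffineMap.apply_lineMap]
    have h1 : a < AffineMap.lineMap a b y := by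
      rw [AffineMap.lineMap_apply, vsub_eq_sub, vadd_eq_add, smul_eq_mul]
      nlinarith [hy.1]
    have h2 : AffineMap.lineMap a b y < b := by
      rw [AffineMap.lineMap_apply, vsub_eq_sub, vadd_eq_add, smul_eq_mul]
      nlinarith [hy.2]
    constructor
    · intro h
      rcases le_total (AffineMap.lineMap a b y) u with h3 | h3
      · exact h1.not_ge (hamax ⟨h, ha.1.trans h1.le, h3⟩)
      · exact huE (hSE.out h0E h ⟨hu.1, h3⟩)
    · intro h
      rcases le_total (AffineMap.lineMap a b y) u with h3 | h3
      · exact huF (hSF.out h h1F ⟨h3, hu.2⟩)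
      · exact h2.not_ge (hbmin ⟨h, h3, h2.le.trans hb.2⟩)
  · refine ⟨c * ((b - u) / (b - a)), c * ((u - a) / (b - a)), by
      have := sub_pos.2 hub; positivity, by have := sub_pos.2 hau; positivity, ?_⟩
    rw [mul_smul, mul_smul, ← smul_add, eq_comm, ← eq_inv_smul_iff₀ hc0.ne', ← huw]
    simp only [AffineMap.lineMap_apply_module]
    match_scalars <;> field_simp <;> ring

theorem measure_convexHull_union_sdiff_le [MeasurableSpace V] [BorelSpace V] {μ : Measure V}
    [μ.IsAddHaarMeasure] (hV : Module.finrank ℝ V = 2) {E F : Set V} (hE : Convex ℝ E)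
    (hF : Convex ℝ F) (hEc : IsCompact E) (hFc : IsCompact F) (hE0 : E ∈ 𝓝 0) (hF0 : F ∈ 𝓝 0)
    {C : ℝ} (hC : ∀ w ∈ convexHull ℝ (E ∪ F), gauge E w ≤ C) :
    μ (convexHull ℝ (E ∪ F) \ (E ∪ F)) ≤ ENNReal.ofReal C * μ (symmDiff E F) := by
  have : FiniteDimensional ℝ V := Module.finite_of_finrank_eq_succ hV
  set K := convexHull ℝ (E ∪ F) with hKdef
  have hK : Convex ℝ K := convex_convexHull ℝ _
  have hEK : E ⊆ K := Set.subset_union_left.trans (subset_convexHull ℝ _)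
  have hFK : F ⊆ K := Set.subset_union_right.trans (subset_convexHull ℝ _)
  set I : Set (V × V) := {e | IsGapEdge E F K e.1 e.2} with hI
  have hopen : ∀ e ∈ I, IsOpen (openCone e.1 e.2) := fun e he ↦ by
    obtain ⟨l, h1, h2, -⟩ := he.2.2.1
    exact isOpen_openCone hV
      (linearIndependent_pair_of_eq_one (l : V →ₗ[ℝ] ℝ) h1 h2 (he.ne hF))
  have hdisj : I.PairwiseDisjoint fun e ↦ openCone e.1 e.2 := by
    intro e he e' he' hee
    refine Set.disjoint_left.2 fun w hw hw' ↦ hee ?_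
    obtain ⟨h1, h2⟩ := IsGapEdge.eq_of_mem_openCone hV hE hF hEK hFK he he' hw hw'
    exact Prod.ext h1 h2
  -- Disjoint nonempty open sets in a separable space are countably many.
  have hcount : I.Countable := hdisj.countable_of_isOpen hopen
    fun e _ ↦ ⟨_, 1, 1, one_pos, one_pos, rfl⟩
  have hmeas : MeasurableSet (symmDiff E F) := hEc.measurableSet.symmDiff hFc.measurableSet
  calc μ (K \ (E ∪ F)) ≤ μ (⋃ e ∈ I, (K \ (E ∪ F)) ∩ openCone e.1 e.2) := by
        refine measure_mono fun w hw ↦ ?_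
        obtain ⟨p, q, h, hwpq⟩ := exists_isGapEdge hE hF hEc hFc hE0 hF0 hw
        exact Set.mem_iUnion₂.2 ⟨(p, q), h, hw, hwpq⟩
    _ ≤ ∑' e : I, μ ((K \ (E ∪ F)) ∩ openCone e.1.1 e.1.2) := measure_biUnion_le μ hcount _
    _ ≤ ∑' e : I, ENNReal.ofReal C * μ (symmDiff E F ∩ openCone e.1.1 e.1.2) :=
        ENNReal.tsum_le_tsum fun e ↦ IsGapEdge.measure_gap_inter_le hV hE hF hK hE0 hF0
          hEc.isClosed hFc.isClosed hEK hFK hC e.2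
    _ = ENNReal.ofReal C * μ (⋃ e ∈ I, symmDiff E F ∩ openCone e.1 e.2) := by
        rw [ENNReal.tsum_mul_left, measure_biUnion hcount
          (hdisj.mono fun e ↦ Set.inter_subset_right)
          fun e he ↦ hmeas.inter (hopen e he).measurableSet]
    _ ≤ ENNReal.ofReal C * μ (symmDiff E F) := by
        gcongr
        exact Set.iUnion₂_subset fun e _ ↦ Set.inter_subset_left

end

/-! ### Sections, widths and the deficit -/

theorem IsCompact.prodMk_preimage {A : Set (ℝ × ℝ)} (hA : IsCompact A) (x : ℝ) :
    IsCompact (Prod.mk x ⁻¹' A) := by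
  have : Prod.mk x ⁻¹' A = Prod.snd '' (A ∩ Prod.fst ⁻¹' {x}) := by
    ext y
    simp
  rw [this]
  exact (hA.inter_right (isClosed_singleton.preimage continuous_fst)).image continuous_snd

theorem Convex.exists_prodMk_preimage_eq_Icc {A : Set (ℝ × ℝ)} (hA : Convex ℝ A)
    (hAc : IsCompact A) {x : ℝ} (hx : x ∈ Prod.fst '' A) :
    ∃ a b, a ≤ b ∧ Prod.mk x ⁻¹' A = Set.Icc a b := by
  obtain ⟨⟨x', y⟩, hy, hx'⟩ := hx
  obtain rfl : x = x' := hx'.symm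
  have hconv : Convex ℝ (Prod.mk x ⁻¹' A) := by
    intro y hy z hz a b ha hb hab
    have := hA hy hz ha hb hab
    simpa [← add_mul, hab] using this
  have h := eq_Icc_of_connected_compact ⟨⟨y, hy⟩, hconv.isPreconnected⟩ (hAc.prodMk_preimage x)
  refine ⟨_, _, ?_, h⟩
  rw [← Set.nonempty_Icc, ← h]
  exact ⟨y, hy⟩

/-- Over each point of the common projection the sections are intervals, and the section of the
combination contains the combination of the sections. With equal projections area is thus concave
without a square root. -/
theorem volume_combo_ge_of_fst_image_eq {A B : Set (ℝ × ℝ)} (hA : Convex ℝ A) (hB : Convex ℝ B)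
    (hAc : IsCompact A) (hBc : IsCompact B) (hAB : Prod.fst '' A = Prod.fst '' B) {p q : ℝ}
    (hp : 0 ≤ p) (hq : 0 ≤ q) (hpq : p + q = 1) :
    ENNReal.ofReal p * volume A + ENNReal.ofReal q * volume B ≤ volume (p • A + q • B) := by
  have hCc : IsCompact (p • A + q • B) := (hAc.smul p).add (hBc.smul q)
  have hC : Convex ℝ (p • A + q • B) := (hA.smul p).add (hB.smul q)
  rw [Measure.volume_eq_prod, Measure.prod_apply hAc.measurableSet,
    Measure.prod_apply hBc.measurableSet, Measure.prod_apply hCc.measurableSet,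
    ← lintegral_const_mul _ (measurable_measure_prodMk_left hAc.measurableSet),
    ← lintegral_const_mul _ (measurable_measure_prodMk_left hBc.measurableSet),
    ← lintegral_add_left
      ((measurable_measure_prodMk_left hAc.measurableSet).const_mul _)]
  refine lintegral_mono fun x ↦ ?_
  by_cases hx : x ∈ Prod.fst '' A
  · obtain ⟨a, b, hab, hA'⟩ := hA.exists_prodMk_preimage_eq_Icc hAc hx
    obtain ⟨c, d, hcd, hB'⟩ := hB.exists_prodMk_preimage_eq_Icc hBc (hAB ▸ hx)
    have hmem : ∀ y ∈ Set.Icc a b, ∀ z ∈ Set.Icc c d,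
        p * y + q * z ∈ Prod.mk x ⁻¹' (p • A + q • B) := by
      intro y hy z hz
      rw [← hA'] at hy
      rw [← hB'] at hz
      refine ⟨_, Set.smul_mem_smul_set hy, _, Set.smul_mem_smul_set hz, ?_⟩
      simp [← add_mul, hpq]
    have hCx : x ∈ Prod.fst '' (p • A + q • B) :=
      ⟨_, hmem a ⟨le_rfl, hab⟩ c ⟨le_rfl, hcd⟩, rfl⟩
    obtain ⟨e, f, hef, hC'⟩ := hC.exists_prodMk_preimage_eq_Icc hCc hCx
    rw [hC'] at hmem
    have h1 := (hmem a ⟨le_rfl, hab⟩ c ⟨le_rfl, hcd⟩).1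
    have h2 := (hmem b ⟨hab, le_rfl⟩ d ⟨hcd, le_rfl⟩).2
    simp only [hA', hB', hC', Real.volume_Icc]
    rw [← ENNReal.ofReal_mul hp, ← ENNReal.ofReal_mul hq, ← ENNReal.ofReal_add
      (mul_nonneg hp (sub_nonneg.2 hab)) (mul_nonneg hq (sub_nonneg.2 hcd))]
    exact ENNReal.ofReal_le_ofReal (by linarith)
  · have hempty : ∀ {D : Set (ℝ × ℝ)}, x ∉ Prod.fst '' D → Prod.mk x ⁻¹' D = ∅ := fun h ↦
      Set.eq_empty_of_forall_notMem fun y hy ↦ h ⟨_, hy, rfl⟩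
    simp [hempty hx, hempty (hAB ▸ hx)]

section

variable {V : Type*} [NormedAddCommGroup V] [NormedSpace ℝ V]

theorem exists_equiv_prod_fst_eq (hV : Module.finrank ℝ V = 2) {f : V →L[ℝ] ℝ} (hf : f ≠ 0) :
    ∃ Φ : V ≃L[ℝ] ℝ × ℝ, ∀ v, (Φ v).1 = f v := by
  have : FiniteDimensional ℝ V := Module.finite_of_finrank_eq_succ hV
  obtain ⟨v, hv⟩ : ∃ v, f v ≠ 0 := by
    by_contra! h
    exact hf (ContinuousLinearMap.ext h)
  have hker : Module.finrank ℝ (LinearMap.ker (f : V →ₗ[ℝ] ℝ)) = 1 := by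
    have h1 := LinearMap.finrank_range_add_finrank_ker (f : V →ₗ[ℝ] ℝ)
    have h2 : LinearMap.range (f : V →ₗ[ℝ] ℝ) = ⊤ :=
      LinearMap.range_eq_top.2 (LinearMap.surjective fun h ↦ hv (by
        simpa using congrArg (fun g : V →ₗ[ℝ] ℝ ↦ g v) h))
    rw [h2, finrank_top, Module.finrank_self, hV] at h1
    omega
  obtain ⟨k, hk0, -⟩ := finrank_eq_one_iff'.1 hker
  have hfk : f k = 0 := k.2
  have hk0' : (k : V) ≠ 0 := by simpa using hk0
  obtain ⟨b, hb0, hb1⟩ := exists_basis_pair hV (p := (f v)⁻¹ • v) (q := k) (by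
    rw [LinearIndependent.pair_iff]
    intro s t hst
    have h := congrArg f hst
    simp only [map_add, map_smul, hfk, smul_eq_mul, inv_mul_cancel₀ hv, map_zero, mul_one,
      mul_zero, add_zero] at h
    subst h
    rw [zero_smul, zero_add] at hst
    exact ⟨rfl, (smul_eq_zero.1 hst).resolve_right hk0'⟩)
  refine ⟨(b.equivFun.trans (LinearEquiv.finTwoArrow ℝ ℝ)).toContinuousLinearEquiv, fun w ↦ ?_⟩
  conv_rhs => rw [← b.sum_repr w, Fin.sum_univ_two, hb0, hb1]
  simp [hfk, hv]

variable [MeasurableSpace V] [BorelSpace V] {μ : Measure V} [μ.IsAddHaarMeasure]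

theorem measure_combo_ge_of_image_eq (hV : Module.finrank ℝ V = 2) {f : V →L[ℝ] ℝ} (hf : f ≠ 0)
    {A B : Set V} (hA : Convex ℝ A) (hB : Convex ℝ B)
    (hAc : IsCompact A) (hBc : IsCompact B) (hAB : f '' A = f '' B) {p q : ℝ}
    (hp : 0 ≤ p) (hq : 0 ≤ q) (hpq : p + q = 1) :
    ENNReal.ofReal p * μ A + ENNReal.ofReal q * μ B ≤ μ (p • A + q • B) := by
  have : FiniteDimensional ℝ V := Module.finite_of_finrank_eq_succ hV
  obtain ⟨Φ, hΦ⟩ := exists_equiv_prod_fst_eq hV hf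
  have hmap := Measure.isAddLeftInvariant_eq_smul (μ.map Φ) (volume : Measure (ℝ × ℝ))
  set c := (μ.map Φ).addHaarScalarFactor (volume : Measure (ℝ × ℝ))
  have hμ : ∀ S, μ S = c * volume (Φ '' S) := by
    intro S
    have h := congrArg (fun ν : Measure (ℝ × ℝ) ↦ ν (Φ '' S)) hmap
    have he : (μ.map Φ) (Φ '' S) = μ S := by
      have := Φ.toHomeomorph.toMeasurableEquiv.map_apply (μ := μ) (Φ '' S)
      exact this.trans (congrArg μ (Set.preimage_image_eq S Φ.injective))
    rw [he] at h
    exact h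
  have hfst : ∀ S : Set V, Prod.fst '' (Φ '' S) = f '' S := fun S ↦ by
    rw [Set.image_image]
    exact Set.image_congr fun v _ ↦ hΦ v
  have h := volume_combo_ge_of_fst_image_eq (hA.linear_image (Φ : V →ₗ[ℝ] ℝ × ℝ))
    (hB.linear_image (Φ : V →ₗ[ℝ] ℝ × ℝ)) (hAc.image Φ.continuous) (hBc.image Φ.continuous)
    ((hfst A).trans (hAB.trans (hfst B).symm)) hp hq hpq
  have himage : Φ '' (p • A + q • B) = p • (Φ '' A) + q • (Φ '' B) := by
    rw [Set.image_add, Set.image_smul_comm _ _ _ (map_smul Φ _), Set.image_smul_comm _ _ _ (map_smul Φ _)]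
  rw [hμ, hμ, hμ, himage]
  calc _ = c * (ENNReal.ofReal p * volume (Φ '' A) + ENNReal.ofReal q * volume (Φ '' B)) := by ring
    _ ≤ _ := by gcongr; exact h

theorem measureReal_smul_of_finrank_two (hV : Module.finrank ℝ V = 2) {r : ℝ} (S : Set V) :
    μ.real (r • S) = r ^ 2 * μ.real S := by
  have : FiniteDimensional ℝ V := Module.finite_of_finrank_eq_succ hV
  rw [measureReal_def, Measure.addHaar_smul, hV, ENNReal.toReal_mul,
    ENNReal.toReal_ofReal (abs_nonneg _), abs_of_nonneg (sq_nonneg r), measureReal_def]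

/-- Rescale both bodies so that `f` has image `[0, 1]` on each. Then `E + F` is a translated dilate,
by the sum of the widths, of a convex combination of the normalised bodies. -/
theorem measureReal_add_ge_of_widths (hV : Module.finrank ℝ V = 2) {f : V →L[ℝ] ℝ} (hf : f ≠ 0)
    {E F : Set V} (hE : Convex ℝ E) (hF : Convex ℝ F) (hEc : IsCompact E) (hFc : IsCompact F)
    {a b c d : ℝ} (hab : a < b) (hcd : c < d) (hfE : f '' E = Set.Icc a b)
    (hfF : f '' F = Set.Icc c d) :
    ((b - a) + (d - c)) * (μ.real E / (b - a) + μ.real F / (d - c)) ≤ μ.real (E + F) := by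
  have : FiniteDimensional ℝ V := Module.finite_of_finrank_eq_succ hV
  have key : ∀ {S : Set V} {s t : ℝ} {x : V}, s < t → f '' S = Set.Icc s t → f x = s →
      f '' ((t - s)⁻¹ • (-x +ᵥ S)) = Set.Icc 0 1 := by
    intro S s t x hst hS hx
    have hts : t - s ≠ 0 := (sub_pos.2 hst).ne'
    have : f '' ((t - s)⁻¹ • (-x +ᵥ S)) = (fun y ↦ (t - s)⁻¹ * (y + -s)) '' (f '' S) := by
      simp only [← Set.image_smul, ← Set.image_vadd, Set.image_image]
      refine Set.image_congr fun y _ ↦ ?_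
      simp [hx]; ring
    rw [this, hS]
    ext y
    constructor
    · rintro ⟨z, hz, rfl⟩
      have h0 : 0 < (t - s)⁻¹ := inv_pos.2 (sub_pos.2 hst)
      refine ⟨mul_nonneg h0.le (by linarith [hz.1]), ?_⟩
      rw [inv_mul_le_iff₀ (sub_pos.2 hst)]
      linarith [hz.2]
    · intro hy
      refine ⟨s + (t - s) * y, ⟨?_, ?_⟩, ?_⟩
      · nlinarith [hy.1]
      · nlinarith [hy.2]
      · simp only; field_simp; ring
  obtain ⟨x, hx, hfx⟩ : a ∈ f '' E := hfE ▸ ⟨le_rfl, hab.le⟩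
  obtain ⟨y, hy, hfy⟩ : c ∈ f '' F := hfF ▸ ⟨le_rfl, hcd.le⟩
  set u := b - a with hu
  set v := d - c with hv
  have hu0 : 0 < u := sub_pos.2 hab
  have hv0 : 0 < v := sub_pos.2 hcd
  have h := measure_combo_ge_of_image_eq (μ := μ) (p := u / (u + v)) (q := v / (u + v)) hV hf
    ((hE.vadd (-x)).smul u⁻¹) ((hF.vadd (-y)).smul v⁻¹) ((hEc.vadd (-x)).smul u⁻¹)
    ((hFc.vadd (-y)).smul v⁻¹) ((key hab hfE hfx).trans (key hcd hfF hfy).symm)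
    (by positivity) (by positivity) (by field_simp)
  set A := u⁻¹ • (-x +ᵥ E) with hA
  set B := v⁻¹ • (-y +ᵥ F) with hB
  have hAc : IsCompact A := (hEc.vadd (-x)).smul u⁻¹
  have hBc : IsCompact B := (hFc.vadd (-y)).smul v⁻¹
  have hEA : E = x +ᵥ u • A := by
    rw [hA, smul_inv_smul₀ hu0.ne', vadd_vadd, add_neg_cancel, zero_vadd]
  have hFB : F = y +ᵥ v • B := by
    rw [hB, smul_inv_smul₀ hv0.ne', vadd_vadd, add_neg_cancel, zero_vadd]
  have hEF : E + F = (x + y) +ᵥ (u + v) • ((u / (u + v)) • A + (v / (u + v)) • B) := by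
    have huv : u + v ≠ 0 := by positivity
    rw [smul_add, smul_smul _ _ A, smul_smul _ _ B, mul_div_cancel₀ _ huv, mul_div_cancel₀ _ huv]
    conv_lhs => rw [hEA, hFB]
    rw [vadd_add_assoc, add_vadd_comm, add_vadd]
  have hμE : μ.real E = u ^ 2 * μ.real A := by
    rw [hEA, measureReal_def, measure_vadd, ← measureReal_def, measureReal_smul_of_finrank_two hV]
  have hμF : μ.real F = v ^ 2 * μ.real B := by
    rw [hFB, measureReal_def, measure_vadd, ← measureReal_def, measureReal_smul_of_finrank_two hV]
  have hμEF : μ.real (E + F) =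
      (u + v) ^ 2 * μ.real ((u / (u + v)) • A + (v / (u + v)) • B) := by
    rw [hEF, measureReal_def, measure_vadd, ← measureReal_def, measureReal_smul_of_finrank_two hV]
  have hreal : u / (u + v) * μ.real A + v / (u + v) * μ.real B ≤
      μ.real ((u / (u + v)) • A + (v / (u + v)) • B) := by
    have hfin : μ ((u / (u + v)) • A + (v / (u + v)) • B) ≠ ∞ :=
      ((hAc.smul _).add (hBc.smul _)).measure_ne_top
    have := ENNReal.toReal_mono hfin h
    rwa [ENNReal.toReal_add (ENNReal.mul_ne_top ENNReal.ofReal_ne_top hAc.measure_ne_top)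
      (ENNReal.mul_ne_top ENNReal.ofReal_ne_top hBc.measure_ne_top), ENNReal.toReal_mul,
      ENNReal.toReal_mul, ENNReal.toReal_ofReal (by positivity),
      ENNReal.toReal_ofReal (by positivity)] at this
  rw [hμE, hμF, hμEF]
  calc (u + v) * (u ^ 2 * μ.real A / u + v ^ 2 * μ.real B / v)
      = (u + v) ^ 2 * (u / (u + v) * μ.real A + v / (u + v) * μ.real B) := by field_simp
    _ ≤ _ := by gcongr

/-- The centre property bounds the width of `E` by three times the reach of `f` from `m`, so
differences in `sF` have `f`-value at most `3 · 11/10 = 33/10` times that reach. -/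
theorem homothety_center_mem_of_widths (hV : Module.finrank ℝ V = 2)
    {E F : Set V} (hE : Convex ℝ E) (hF : Convex ℝ F) (hEc : IsCompact E) (hFc : IsCompact F)
    (hE0 : μ E ≠ 0) {s : ℝ} (hs : 0 < s)
    (hw : ∀ f : V →L[ℝ] ℝ, f ≠ 0 → ∀ a b c d, a < b → c < d → f '' E = Set.Icc a b →
      f '' F = Set.Icc c d → s * (d - c) ≤ 11 / 10 * (b - a))
    {m : V} (hm : ∀ x ∈ E, m + (1 / 2 : ℝ) • (m - x) ∈ E) {x y : V} (hx : x ∈ F) (hy : y ∈ F) :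
    m + (10 / 33 * s) • (x - y) ∈ E := by
  have : FiniteDimensional ℝ V := Module.finite_of_finrank_eq_succ hV
  by_contra hxy
  obtain ⟨f, u, hfu, huf⟩ := geometric_hahn_banach_closed_point hE hEc.isClosed hxy
  have hIcc : ∀ {S : Set V}, Convex ℝ S → IsCompact S → S.Nonempty →
      ∃ a b, f '' S = Set.Icc a b := fun hS hSc hS0 ↦
    ⟨_, _, eq_Icc_of_connected_compact
      ⟨hS0.image f, (hS.linear_image (f : V →ₗ[ℝ] ℝ)).isPreconnected⟩ (hSc.image f.continuous)⟩
  have hne : E.Nonempty := nonempty_of_measure_ne_zero hE0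
  obtain ⟨a, b, hab⟩ := hIcc hE hEc hne
  obtain ⟨c, d, hcd⟩ := hIcc hF hFc ⟨x, hx⟩
  have hble : a ≤ b := Set.nonempty_Icc.1 (hab ▸ hne.image f)
  obtain ⟨e, he, rfl⟩ : a ∈ f '' E := hab ▸ ⟨le_rfl, hble⟩
  obtain ⟨e', he', rfl⟩ : b ∈ f '' E := hab ▸ ⟨hble, le_rfl⟩
  have hmE := hm e he
  have h1 : f (m + (1 / 2 : ℝ) • (m - e)) ≤ f e' :=
    (hab ▸ Set.mem_image_of_mem f hmE : f (m + (1 / 2 : ℝ) • (m - e)) ∈ Set.Icc (f e) (f e')).2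
  have h2 := hfu _ he'
  have hfx : f x ∈ Set.Icc c d := hcd ▸ Set.mem_image_of_mem f hx
  have hfy : f y ∈ Set.Icc c d := hcd ▸ Set.mem_image_of_mem f hy
  simp only [map_add, map_smul, map_sub, smul_eq_mul] at h1 huf
  have h3 : s * (f x - f y) ≤ s * (d - c) := by
    have := hfx.2
    have := hfy.1
    gcongr
  have hcd' : c < d := by
    by_contra! h
    have : s * (d - c) ≤ 0 := mul_nonpos_of_nonneg_of_nonpos hs.le (by linarith)
    linarith
  have hf0 : f ≠ 0 := by
    rintro rfl
    simp at h2 huf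
    linarith
  have hab' : f e < f e' := by
    refine lt_of_le_of_ne hble fun h ↦ hE0 ?_
    have hsub : E ⊆ e +ᵥ ((LinearMap.ker (f : V →ₗ[ℝ] ℝ) : Submodule ℝ V) : Set V) := by
      intro z hz
      have hfz : f z ∈ Set.Icc (f e) (f e') := hab ▸ Set.mem_image_of_mem f hz
      refine ⟨z - e, ?_, by simp⟩
      have : f (z - e) = 0 := by
        rw [map_sub]; linarith [hfz.1, hfz.2]
      exact this
    refine measure_mono_null hsub ?_
    rw [measure_vadd]
    refine Measure.addHaar_submodule μ _ fun htop ↦ hf0 ?_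
    have := LinearMap.ker_eq_top.1 htop
    ext v
    simpa using congrArg (fun g : V →ₗ[ℝ] ℝ ↦ g v) this
  have h4 := hw f hf0 _ _ _ _ hab' hcd' hab hcd
  linarith

end

/-- The width bound exceeds `(a + b)²` by exactly `(av - bu)²/(uv)`. As `ab ≥ (τ/2)(a + b)²`, the
deficit bound gives `(X - Y)² ≤ 0.006 XY` for `X = av`, `Y = bu`, which excludes `X > 1.1 Y`. -/
theorem width_le_of_deficit {a b u v τ S : ℝ} (ha : 0 < a) (hb : 0 < b) (hu : 0 < u) (hv : 0 < v)
    (hτ0 : 0 < τ) (hτ : τ ≤ 1 / 2) (h1 : τ * (a + b) ≤ a) (h2 : τ * (a + b) ≤ b)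
    (hS : S ≤ ((1 + τ / 1000) * (a + b)) ^ 2) (h : (u + v) * (a ^ 2 / u + b ^ 2 / v) ≤ S) :
    a / b * v ≤ 11 / 10 * u := by
  have hid : (u + v) * (a ^ 2 / u + b ^ 2 / v) =
      (a + b) ^ 2 + (a * v - b * u) ^ 2 / (u * v) := by
    field_simp; ring
  have h3 : (a * v - b * u) ^ 2 / (u * v) ≤ 3 * τ / 1000 * (a + b) ^ 2 := by
    have : 0 ≤ (a + b) ^ 2 * τ * (1 - τ) := by
      have : 0 ≤ 1 - τ := by linarith
      positivity
    nlinarith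
  rw [div_le_iff₀ (by positivity)] at h3
  have h4 : τ / 2 * (a + b) ^ 2 ≤ a * b := by
    nlinarith [mul_nonneg (sub_nonneg.2 h1) (sub_nonneg.2 h2), mul_pos hτ0 (sq_pos_of_pos (add_pos ha hb))]
  have h5 : (a * v - b * u) ^ 2 ≤ 6 / 1000 * ((a * v) * (b * u)) := by
    calc (a * v - b * u) ^ 2 ≤ 3 * τ / 1000 * (a + b) ^ 2 * (u * v) := h3
      _ = 6 / 1000 * (τ / 2 * (a + b) ^ 2) * (u * v) := by ring
      _ ≤ 6 / 1000 * (a * b) * (u * v) := by gcongr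
      _ = _ := by ring
  rw [div_mul_eq_mul_div, div_le_iff₀ hb]
  have hY : 0 < b * u := by positivity
  by_contra! h6
  nlinarith

/-! ### The regimes of small and large asymmetry -/

section

variable {V : Type*} [NormedAddCommGroup V] [NormedSpace ℝ V] [MeasurableSpace V] [BorelSpace V]
  {μ : Measure V} [μ.IsAddHaarMeasure]

theorem measure_convexHull_union_sdiff_le_of_center (hV : Module.finrank ℝ V = 2) {E F : Set V}
    (hE : Convex ℝ E) (hF : Convex ℝ F) (hEc : IsCompact E) (hFc : IsCompact F) {m : V}
    (hm : m ∈ interior (E ∩ F)) (h : ∀ w ∈ E ∪ F, m + (1 / 10 : ℝ) • (w - m) ∈ E) :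
    μ (convexHull ℝ (E ∪ F) \ (E ∪ F)) ≤ 10 * μ (symmDiff E F) := by
  have : FiniteDimensional ℝ V := Module.finite_of_finrank_eq_succ hV
  have hnhds : ∀ {S : Set V}, E ∩ F ⊆ S → -m +ᵥ S ∈ 𝓝 (0 : V) := fun {S} hS ↦ by
    have h1 : S ∈ 𝓝 m := mem_interior_iff_mem_nhds.1 (interior_mono hS hm)
    have := vadd_mem_nhds_vadd (-m) h1
    simpa using this
  have hunion : (-m +ᵥ E) ∪ (-m +ᵥ F) = -m +ᵥ (E ∪ F) := (Set.vadd_set_union).symm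
  have hE1 : Convex ℝ (-m +ᵥ E) := hE.vadd (-m)
  have hE0 := hnhds Set.inter_subset_left
  have hgap := measure_convexHull_union_sdiff_le (μ := μ) (C := 10) hV hE1 (hF.vadd (-m))
    (hEc.vadd (-m)) (hFc.vadd (-m)) hE0 (hnhds Set.inter_subset_right) (by
      have hsub : convexHull ℝ ((-m +ᵥ E) ∪ (-m +ᵥ F)) ⊆ (10 : ℝ) • (-m +ᵥ E) := by
        refine convexHull_min ?_ (hE1.smul 10)
        rw [hunion]
        rintro _ ⟨w, hw, rfl⟩
        rw [Set.mem_smul_set_iff_inv_smul_mem₀ (by norm_num)]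
        refine ⟨_, h w hw, ?_⟩
        simp only [vadd_eq_add]
        module
      exact fun w hw ↦ gauge_le_of_mem (by norm_num) (hsub hw))
  rw [hunion, convexHull_vadd, ← Set.vadd_set_sdiff, measure_vadd, ← Set.vadd_set_symmDiff,
    measure_vadd] at hgap
  simpa using hgap

theorem exists_convex_superset_of_symmDiff_le (hV : Module.finrank ℝ V = 2) {E F : Set V}
    (hE : Convex ℝ E) (hF : Convex ℝ F) (hEc : IsCompact E) (hFc : IsCompact F) (hE0 : μ E ≠ 0)
    (hEF : μ E = μ F) (h : μ (symmDiff E F) ≤ ENNReal.ofReal (3 / 5) * μ E) :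
    ∃ K, Convex ℝ K ∧ E ⊆ K ∧ F ⊆ K ∧ μ (K \ E) ≤ 11 * μ (symmDiff E F) ∧
      μ (K \ F) ≤ 11 * μ (symmDiff E F) := by
  have : FiniteDimensional ℝ V := Module.finite_of_finrank_eq_succ hV
  have hEt : μ E ≠ ∞ := hEc.measure_ne_top
  have hFt : μ F ≠ ∞ := hFc.measure_ne_top
  have hEm := hEc.measurableSet
  have hFm := hFc.measurableSet
  set M := E ∩ F with hMdef
  have hM : Convex ℝ M := hE.inter hF
  have hMc : IsCompact M := hEc.inter hFc
  have hcomm : μ (E \ F) = μ (F \ E) :=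
    measure_sdiff_comm_of_eq hEm.nullMeasurableSet hFm.nullMeasurableSet hEF hFt
  have h2 : 2 * μ (E \ F) ≤ ENNReal.ofReal (3 / 5) * μ E := by
    rwa [← measure_symmDiff_eq_two_mul_of_eq hEm.nullMeasurableSet hFm.nullMeasurableSet hEF hFt]
  have hsplit : μ M + μ (E \ F) = μ E := measure_inter_add_sdiff E hFm
  have hMt : μ M ≠ ∞ := hMc.measure_ne_top
  have hDt : μ (E \ F) ≠ ∞ := measure_ne_top_of_subset Set.sdiff_subset hEt
  -- From `2y ≤ (3/5)(x + y)` one gets `y ≤ (3/7)x`, and `3/7 < 9/16`.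
  have hlt : μ (E \ F) < ENNReal.ofReal (9 / 16) * μ M := by
    have hEr := ENNReal.toReal_pos hE0 hEt
    rw [← hsplit] at h2 hEr
    lift μ M to NNReal using hMt with x
    lift μ (E \ F) to NNReal using hDt with y
    rw [← ENNReal.toReal_le_toReal (by finiteness) (by finiteness)] at h2
    rw [← ENNReal.toReal_lt_toReal (by finiteness) (by finiteness)]
    simp only [ENNReal.toReal_mul, ENNReal.toReal_add ENNReal.coe_ne_top ENNReal.coe_ne_top,
      ENNReal.coe_toReal, ENNReal.toReal_ofNat] at h2 hEr ⊢
    rw [ENNReal.toReal_ofReal (by norm_num)] at h2 ⊢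
    linarith
  have hM0 : μ M ≠ 0 := fun h0 ↦ by simp [h0] at hlt
  obtain ⟨m, hm⟩ := exists_center hV hM hMc (nonempty_of_measure_ne_zero hM0)
  have hmi := center_mem_interior hM (hM.interior_nonempty_of_measure_ne_zero hM0) hm
  have hmem : ∀ w ∈ E ∪ F, m + (1 / 10 : ℝ) • (w - m) ∈ M := by
    rintro w (hw | hw)
    · exact homothety_center_mem (μ := μ) hV hM hMc.isClosed hE Set.inter_subset_left hm
        (by rwa [hMdef, Set.sdiff_self_inter]) hw
    · exact homothety_center_mem (μ := μ) hV hM hMc.isClosed hF Set.inter_subset_right hm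
        (by rwa [hMdef, Set.inter_comm, Set.sdiff_self_inter, ← hcomm, Set.inter_comm]) hw
  have hgap := measure_convexHull_union_sdiff_le_of_center (μ := μ) hV hE hF hEc hFc hmi
    fun w hw ↦ (hmem w hw).1
  have key : ∀ {A B : Set V}, A ∪ B = E ∪ F → B \ A ⊆ symmDiff E F →
      μ (convexHull ℝ (E ∪ F) \ A) ≤ 11 * μ (symmDiff E F) := by
    intro A B hAB hBA
    calc μ (convexHull ℝ (E ∪ F) \ A)
        ≤ μ (convexHull ℝ (E ∪ F) \ (E ∪ F) ∪ B \ A) := by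
          refine measure_mono ?_
          rintro w ⟨hw, hwA⟩
          by_cases hwB : w ∈ B
          · exact Or.inr ⟨hwB, hwA⟩
          · exact Or.inl ⟨hw, hAB ▸ fun h ↦ h.elim hwA hwB⟩
      _ ≤ 10 * μ (symmDiff E F) + μ (symmDiff E F) :=
          (measure_union_le _ _).trans (add_le_add hgap (measure_mono hBA))
      _ = 11 * μ (symmDiff E F) := by ring
  exact ⟨convexHull ℝ (E ∪ F), convex_convexHull ℝ _,
    Set.subset_union_left.trans (subset_convexHull ℝ _),
    Set.subset_union_right.trans (subset_convexHull ℝ _), key rfl Set.subset_union_right,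
    key (Set.union_comm F E) Set.subset_union_left⟩

end

/-- A single convex `K` around `E` and the rescaled copy of `F` suffices: undoing the homothety on
`K` gives the set around `F` and preserves relative excess. -/
theorem figalliJerison_le {n : ℕ} {E F K : Set (EuclideanSpace ℝ (Fin n))} {s : ℝ} (hs : 0 < s)
    {x : EuclideanSpace ℝ (Fin n)} (hK : Convex ℝ K) (hEK : E ⊆ K) (hFK : x +ᵥ s • F ⊆ K)
    (hE0 : volume E ≠ 0) (hE : volume E ≠ ∞) (hEF : volume E = volume (s • F)) {c : ℝ≥0∞}
    (h1 : volume (K \ E) ≤ c * volume E) (h2 : volume (K \ (x +ᵥ s • F)) ≤ c * volume E) :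
    figalliJerison E F ≤ c := by
  set L := s⁻¹ • (-x +ᵥ K) with hL
  have hKL : K = x +ᵥ s • L := by
    rw [hL, smul_inv_smul₀ hs.ne', vadd_vadd, add_neg_cancel, zero_vadd]
  have hFL : F ⊆ L := by
    rwa [hKL, Set.vadd_set_subset_vadd_set_iff, Set.smul_set_subset_smul_set_iff₀ hs.ne'] at hFK
  have hLc : Convex ℝ L := (hK.vadd (-x)).smul s⁻¹
  refine iInf_le_of_le K <| iInf_le_of_le L <| iInf_le_of_le hK <| iInf_le_of_le hLc <|
    iInf_le_of_le ⟨s, hs, x, hKL⟩ <| iInf_le_of_le hEK <| iInf_le_of_le hFL <| max_le ?_ ?_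
  · exact (ENNReal.div_le_iff hE0 hE).2 h1
  · have hEF' : volume E = ENNReal.ofReal (s ^ n) * volume F := by
      rw [hEF, ← volume_vadd_smul F 0 hs.le, zero_vadd]
    have hsn : ENNReal.ofReal (s ^ n) ≠ 0 := (ENNReal.ofReal_pos.2 (pow_pos hs n)).ne'
    rw [hEF'] at hE0 hE
    have hF0 : volume F ≠ 0 := right_ne_zero_of_mul hE0
    have hFt : volume F ≠ ∞ := fun h ↦ hE (by rw [h, ENNReal.mul_top hsn])
    rw [ENNReal.div_le_iff hF0 hFt, ← ENNReal.mul_le_mul_iff_right hsn ENNReal.ofReal_ne_top]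
    calc ENNReal.ofReal (s ^ n) * volume (L \ F) = volume (K \ (x +ᵥ s • F)) := by
          rw [← volume_vadd_smul _ x hs.le, ← sdiff_vadd_smul _ _ _ hs, ← hKL]
      _ ≤ c * volume E := h2
      _ = ENNReal.ofReal (s ^ n) * (c * volume F) := by rw [hEF']; ring

theorem figalliJerison_le_of_symmDiff_le {E F : Set (EuclideanSpace ℝ (Fin 2))}
    (hE : Convex ℝ E) (hF : Convex ℝ F) (hE0 : volume E ≠ 0) (hEt : volume E ≠ ∞) {s : ℝ}
    (hs : 0 < s) (hEF : volume E = volume (s • F)) {x : EuclideanSpace ℝ (Fin 2)}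
    (h : volume (symmDiff E (x +ᵥ s • F)) ≤ ENNReal.ofReal (3 / 5) * volume E) :
    figalliJerison E F ≤ 21 * (volume (symmDiff E (x +ᵥ s • F)) / volume E) := by
  set F' := x +ᵥ s • F with hF'
  have hF'c : Convex ℝ F' := (hF.smul s).vadd x
  have hEF' : volume E = volume F' := by rw [hF', measure_vadd, hEF]
  have hcE : closure E =ᵐ[volume] E := hE.closure_ae_eq
  have hcF : closure F' =ᵐ[volume] F' := hF'c.closure_ae_eq
  have hsd : volume (symmDiff (closure E) (closure F')) = volume (symmDiff E F') :=
    measure_congr (hcE.symmDiff hcF)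
  obtain ⟨K, hK, hEK, hFK, h1, h2⟩ := exists_convex_superset_of_symmDiff_le (μ := volume)
    finrank_euclideanSpace_fin hE.closure hF'c.closure
    (hE.isBounded_of_measure_ne_top hE0 hEt).isCompact_closure
    (hF'c.isBounded_of_measure_ne_top (hEF' ▸ hE0) (hEF' ▸ hEt)).isCompact_closure
    (by rwa [measure_congr hcE]) (by rw [measure_congr hcE, measure_congr hcF, hEF'])
    (by rwa [hsd, measure_congr hcE])
  rw [hsd] at h1 h2
  rw [measure_congr (Filter.EventuallyEq.rfl.diff hcE)] at h1
  rw [measure_congr (Filter.EventuallyEq.rfl.diff hcF)] at h2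
  have h21 : 11 * volume (symmDiff E F') ≤
      21 * (volume (symmDiff E F') / volume E) * volume E := by
    rw [mul_assoc, ENNReal.div_mul_cancel hE0 hEt]
    gcongr
    norm_num
  exact figalliJerison_le hs hK (subset_closure.trans hEK) (subset_closure.trans hFK) hE0 hEt hEF
    (h1.trans h21) (h2.trans h21)

theorem figalliJerison_le_eleven {E F : Set (EuclideanSpace ℝ (Fin 2))}
    (hE : Convex ℝ E) (hF : Convex ℝ F) (hE0 : volume E ≠ 0) (hEt : volume E ≠ ∞)
    (hF0 : volume F ≠ 0) (hFt : volume F ≠ ∞) {τ : ℝ} (hτ0 : 0 < τ) (hτ : τ ≤ 1 / 2)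
    (h1 : τ ≤ volumeRatio E F) (h2 : volumeRatio E F ≤ 1 - τ)
    (hd : bmDeficit E F ≤ τ / 1000) {s : ℝ} (hs : 0 < s) (hEF : volume E = volume (s • F)) :
    figalliJerison E F ≤ 11 := by
  have hV : Module.finrank ℝ (EuclideanSpace ℝ (Fin 2)) = 2 := finrank_euclideanSpace_fin
  have hcE : closure E =ᵐ[volume] E := hE.closure_ae_eq
  have hcF : closure F =ᵐ[volume] F := hF.closure_ae_eq
  have hEb := hE.isBounded_of_measure_ne_top hE0 hEt
  have hFb := hF.isBounded_of_measure_ne_top hF0 hFt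
  -- Closing the summands stays within the closure of `E + F`, whose boundary is null.
  have hsum : volume.real (closure E + closure F) = volume.real (E + F) := by
    refine le_antisymm ?_ (measureReal_mono (Set.add_subset_add subset_closure subset_closure)
      (hEb.isCompact_closure.add hFb.isCompact_closure).measure_ne_top)
    have hcEF : closure (E + F) =ᵐ[volume] (E + F : Set _) := (hE.add hF).closure_ae_eq
    rw [← measureReal_congr hcEF]
    exact measureReal_mono (vadd_set_closure_subset E F)
      (hEb.add hFb).isCompact_closure.measure_ne_top
  have hsqrt : ∀ y : ℝ, y ^ (1 / ((2 : ℕ) : ℝ)) = √y := fun y ↦ by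
    rw [Real.sqrt_eq_rpow]; norm_num
  simp only [volumeRatio, bmDeficit, hsqrt] at h1 h2 hd
  have hEr : 0 < volume.real E := ENNReal.toReal_pos hE0 hEt
  have hFr : 0 < volume.real F := ENNReal.toReal_pos hF0 hFt
  set a := √(volume.real E) with ha
  set b := √(volume.real F) with hb
  have ha0 : 0 < a := Real.sqrt_pos.2 hEr
  have hb0 : 0 < b := Real.sqrt_pos.2 hFr
  have hab : 0 < a + b := add_pos ha0 hb0
  have ha2 : a ^ 2 = volume.real E := Real.sq_sqrt hEr.le
  have hb2 : b ^ 2 = volume.real F := Real.sq_sqrt hFr.le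
  rw [le_div_iff₀ hab] at h1
  rw [div_le_iff₀ hab] at h2
  rw [sub_le_iff_le_add', div_le_iff₀ hab, Real.sqrt_le_left (by positivity)] at hd
  have hsab : s = a / b := by
    have h : volume.real E = s ^ 2 * volume.real F := by
      rw [← measureReal_smul_of_finrank_two hV, measureReal_def, measureReal_def, hEF]
    rw [eq_div_iff hb0.ne', ha, h, Real.sqrt_mul (sq_nonneg s), Real.sqrt_sq hs.le]
  have hE0' : volume (closure E) ≠ 0 := by rwa [measure_congr hcE]
  obtain ⟨m, hm⟩ := exists_center hV hE.closure hEb.isCompact_closure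
    (nonempty_of_measure_ne_zero hE0')
  obtain ⟨y, hy⟩ := nonempty_of_measure_ne_zero hF0
  have hmE : m ∈ closure E := interior_subset <| center_mem_interior hE.closure
    (hE.closure.interior_nonempty_of_measure_ne_zero hE0') hm
  have hmem : ∀ z ∈ F, m + (10 / 33 * s) • (z - y) ∈ closure E := fun z hz ↦
    homothety_center_mem_of_widths (μ := volume) hV hE.closure hF.closure hEb.isCompact_closure
      hFb.isCompact_closure hE0' hs
      (fun f hf p q u v hpq huv hfE hfF ↦ by
        have := measureReal_add_ge_of_widths (μ := volume) hV hf hE.closure hF.closure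
          hEb.isCompact_closure hFb.isCompact_closure hpq huv hfE hfF
        rw [hsum, measureReal_congr hcE, measureReal_congr hcF, ← ha2, ← hb2] at this
        rw [hsab]
        exact width_le_of_deficit ha0 hb0 (sub_pos.2 hpq) (sub_pos.2 huv) hτ0 hτ h1
          (by linarith) hd this)
      hm (subset_closure hz) (subset_closure hy)
  -- `(33/10)² = 10.89`.
  have hKvol : volume (m +ᵥ (33 / 10 : ℝ) • (-m +ᵥ closure E)) ≤ 11 * volume E := by
    rw [volume_vadd_smul _ _ (by norm_num), measure_vadd, measure_congr hcE]
    gcongr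
    rw [ENNReal.ofReal_le_ofNat]
    norm_num
  have hKmem : ∀ w, m + (10 / 33 : ℝ) • (w - m) ∈ closure E →
      w ∈ m +ᵥ (33 / 10 : ℝ) • (-m +ᵥ closure E) := fun w hw ↦ by
    refine ⟨_, ⟨_, ⟨_, hw, rfl⟩, rfl⟩, ?_⟩
    simp only [vadd_eq_add]
    module
  -- This translation places the point `y` of `F` at the centre `m`.
  refine figalliJerison_le (x := m - s • y) hs (((hE.closure.vadd (-m)).smul (33 / 10)).vadd m)
    (fun w hw ↦ hKmem w ?_) ?_ hE0 hEt hEF ((measure_mono Set.sdiff_subset).trans hKvol)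
    ((measure_mono Set.sdiff_subset).trans hKvol)
  · have := hE.closure hmE (subset_closure hw) (a := 23 / 33) (b := 10 / 33) (by norm_num)
      (by norm_num) (by norm_num)
    convert this using 1
    module
  · rintro _ ⟨_, ⟨z, hz, rfl⟩, rfl⟩
    refine hKmem _ ?_
    convert hmem z hz using 1
    simp only [vadd_eq_add]
    module

theorem figalliJerison_le_fraenkelAsymmetry {τ : ℝ} (hτ0 : 0 < τ) (hτ : τ ≤ 1 / 2)
    {E F : Set (EuclideanSpace ℝ (Fin 2))} (hE : Convex ℝ E) (hF : Convex ℝ F)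
    (h1 : τ ≤ volumeRatio E F) (h2 : volumeRatio E F ≤ 1 - τ)
    (hd : bmDeficit E F ≤ τ / 1000) :
    figalliJerison E F ≤ 21 * fraenkelAsymmetry E F := by
  have hzero : (0 : ℝ) ^ (1 / ((2 : ℕ) : ℝ)) = 0 := Real.zero_rpow (by norm_num)
  -- `volume.real` vanishes on sets of area `0` or `∞`, so the bounds on the ratio exclude both.
  have hEr : volume.real E ≠ 0 := fun h ↦ by
    simp only [volumeRatio, h, hzero, zero_div] at h1
    linarith
  have hFr : volume.real F ≠ 0 := fun h ↦ by
    have hpos : 0 < volume.real E := lt_of_le_of_ne measureReal_nonneg hEr.symm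
    have : volume.real E ^ (1 / ((2 : ℕ) : ℝ)) ≠ 0 := (Real.rpow_pos_of_pos hpos _).ne'
    simp only [volumeRatio, h, hzero, add_zero, div_self this] at h2
    linarith
  rw [measureReal_def, ENNReal.toReal_ne_zero] at hEr hFr
  rw [mul_comm, ← ENNReal.div_le_iff (by simp) (by simp), fraenkelAsymmetry, hF.convexHull_eq]
  refine le_iInf fun s ↦ le_iInf fun hs ↦ le_iInf fun hEF ↦ le_iInf fun x ↦ ?_
  rw [ENNReal.div_le_iff (by simp) (by simp), mul_comm]
  rcases le_or_gt (volume (symmDiff E (x +ᵥ s • F))) (ENNReal.ofReal (3 / 5) * volume E)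
    with h | h
  · exact figalliJerison_le_of_symmDiff_le hE hF hEr.1 hEr.2 hs hEF h
  · refine (figalliJerison_le_eleven hE hF hEr.1 hEr.2 hFr.1 hFr.2 hτ0 hτ h1 h2 hd hs hEF).trans ?_
    calc (11 : ℝ≥0∞) ≤ 21 * ENNReal.ofReal (3 / 5) := by
          rw [← ENNReal.ofReal_ofNat 21, ← ENNReal.ofReal_mul (by norm_num),
            ← ENNReal.ofReal_ofNat 11]
          exact ENNReal.ofReal_le_ofReal (by norm_num)
      _ ≤ _ := by
          gcongr
          exact (ENNReal.le_div_iff_mul_le (Or.inl hEr.1) (Or.inl hEr.2)).2 h.le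

theorem mainTheorem3 :
    (∀ τ : ℝ, 0 < τ → τ ≤ 1 / 2 → ∃ d : ℝ, 0 < d ∧
      ∀ E F : Set (EuclideanSpace ℝ (Fin 2)), Convex ℝ E → Convex ℝ F →
        τ ≤ volumeRatio E F → volumeRatio E F ≤ 1 - τ → bmDeficit E F ≤ d →
        figalliJerison E F ≤ 21 * fraenkelAsymmetry E F) ∧
    (∀ n : ℕ, 1 ≤ n → ∀ A B : Set (EuclideanSpace ℝ (Fin n)),
      NullMeasurableSet A → NullMeasurableSet B →
      volume A ≠ 0 → volume A ≠ ∞ → volume B ≠ 0 → volume B ≠ ∞ →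
      fraenkelAsymmetry A B ≤ 2 * figalliJerison A B) := by
  refine ⟨fun τ hτ0 hτ ↦ ⟨τ / 1000, by positivity, fun E F hE hF h1 h2 hd ↦
    figalliJerison_le_fraenkelAsymmetry hτ0 hτ hE hF h1 h2 hd⟩, ?_⟩
  intro n hn A B hA _ hA0 hAt hB0 hBt
  exact fraenkelAsymmetry_le_two_mul_figalliJerison (by omega) hA hA0 hAt hB0 hBt
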